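/- Let $n,m\ge 1$ be integers and let $\mu_n\subset\mathbb{C}^\times$ be the group of $n$-th roots of unity, with character group $\widehat{\mu_n}$. For $r\geq 1$ put \[ T(r,m)=\{(z_1,\dots,z_m)\in\mathbb{C}^m \mid z_i\neq 0\ \forall i,\ z_i^r\neq z_j^r\ \forall i\neq j\}, \] on which the wreath product $W(r,m)=S_m\ltimes\mu_r^m$ acts, $S_m$ by permuting and $\mu_r^m$ by scaling the coordinates. Put \[ T^{(n)}(1,m)=\{((z_i),z)\in T(1,m)\times\mathbb{C}^\times \mid z^n=z_1\cdots z_m\}, \] on which $S_m$ acts by permuting the $z_i$ and $\mu_n$ acts by scaling $z$; these two actions commute. All cohomology is taken with complex coefficients, and $H^i_c$ is cohomology with compact supports. For a finite group $\Gamma$ acting on a variety $X$ and $\gamma\in\Gamma$, let \[ P(\gamma,X,q)=\sum_i(-1)^i\,\mathrm{tr}(\gamma,H^i_c(X))\,q^{i-\dim X}, \] and, if a finite abelian group $\Delta$ acts on $X$ commuting with $\Gamma$ and $\chi$ is a character of $\Delta$, let \[ P(\gamma,\chi,X,q)=\sum_i(-1)^i\,\mathrm{tr}(\gamma,H^i_c(X)_\chi)\,q^{i-\dim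 X}, \] where $H^i_c(X)_\chi$ is the subspace of $H^i_c(X)$ on which every $\delta\in\Delta$ acts as multiplication by $\chi(\delta)$. Then for every $w\in S_m$ and $\chi\in\widehat{\mu_n}$, \[ P(w,\chi^{-1},T^{(n)}(1,m),q)=\frac{1}{n^m}\sum_{(\zeta_1,\dots,\zeta_m)\in\mu_n^m}\chi(\zeta_1\cdots\zeta_m)\,P\bigl(w(\zeta_1,\dots,\zeta_m),T(n,m),q\bigr), \] where $w(\zeta_1,\dots,\zeta_m)$ is the product in $W(n,m)$ of $w\in S_m$ and $(\zeta_1,\dots,\zeta_m)\in\mu_n^m$. -/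

import Mathlib

open scoped Topology

noncomputable section

namespace WeightPoly

/-! ### Compactly supported cohomology with complex coefficients

`H_c^p(X)` is the Alexander–Spanier cohomology with compact supports. On locally compact
Hausdorff spaces it agrees with sheaf cohomology with compact supports in the constant sheaf `ℂ`. -/

section Cohomology

variable {X : Type*} [TopologicalSpace X] {p : ℕ}

/-- Alexander–Spanier cochains of degree `p`, before dividing by the locally zero ones. -/
abbrev Cochain (X : Type*) (p : ℕ) : Type _ := (Fin (p + 1) → X) → ℂ

/-- The coboundary `(δf)(x₀,…,x_{p+1}) = ∑ⱼ (-1)ʲ f(x₀,…,x̂ⱼ,…,x_{p+1})`. -/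
def coboundary (X : Type*) (p : ℕ) : Cochain X p →ₗ[ℂ] Cochain X (p + 1) where
  toFun f x := ∑ j : Fin (p + 2), (-1 : ℂ) ^ (j : ℕ) * f (fun i => x (j.succAbove i))
  map_add' f g := by
    funext x
    simp [mul_add, Finset.sum_add_distrib]
  map_smul' c f := by
    funext x
    simp only [Pi.smul_apply, smul_eq_mul, RingHom.id_apply, Finset.mul_sum]
    exact Finset.sum_congr rfl fun j _ => by ring

/-- The support of a cochain: the points `x` such that the cochain vanishes identically on
`U^{p+1}` for no neighbourhood `U` of `x`. -/
def supp (f : Cochain X p) : Set X :=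
  {x | ¬ ∃ U ∈ 𝓝 x, ∀ y : Fin (p + 1) → X, (∀ i, y i ∈ U) → f y = 0}

theorem isClosed_supp (f : Cochain X p) : IsClosed (supp f) := by
  rw [← isOpen_compl_iff, isOpen_iff_mem_nhds]
  intro x hx
  obtain ⟨U, hU, h⟩ := not_not.1 hx
  filter_upwards [eventually_mem_nhds_iff.2 hU] with y hy
  exact not_not.2 ⟨U, hy, h⟩

theorem supp_zero : supp (0 : Cochain X p) = ∅ :=
  Set.eq_empty_of_forall_notMem fun _ hx => hx ⟨Set.univ, Filter.univ_mem, fun _ _ => rfl⟩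

theorem supp_add (f g : Cochain X p) : supp (f + g) ⊆ supp f ∪ supp g := by
  intro x hx
  by_contra h
  rw [Set.mem_union, not_or] at h
  obtain ⟨U, hU, hf⟩ := not_not.1 h.1
  obtain ⟨V, hV, hg⟩ := not_not.1 h.2
  refine hx ⟨U ∩ V, Filter.inter_mem hU hV, fun y hy => ?_⟩
  simp [hf y fun i => (hy i).1, hg y fun i => (hy i).2]

theorem supp_smul (c : ℂ) (f : Cochain X p) : supp (c • f) ⊆ supp f := by
  intro x hx h
  obtain ⟨U, hU, hf⟩ := h
  exact hx ⟨U, hU, fun y hy => by simp [hf y hy]⟩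

/-- Locally zero cochains. -/
def locallyZero (X : Type*) [TopologicalSpace X] (p : ℕ) : Submodule ℂ (Cochain X p) where
  carrier := {f | supp f = ∅}
  zero_mem' := supp_zero
  add_mem' {f g} hf hg := Set.subset_empty_iff.1 <| (supp_add f g).trans (by
    rw [Set.mem_ofPred_eq] at hf hg
    simp [hf, hg])
  smul_mem' c f hf := Set.subset_empty_iff.1 <| (supp_smul c f).trans (by
    rw [Set.mem_ofPred_eq] at hf
    simp [hf])

/-- Compactly supported cochains. -/
def compactlySupported (X : Type*) [TopologicalSpace X] (p : ℕ) :
    Submodule ℂ (Cochain X p) where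
  carrier := {f | IsCompact (supp f)}
  zero_mem' := by
    rw [Set.mem_ofPred_eq, supp_zero]
    exact isCompact_empty
  add_mem' {f g} hf hg :=
    (IsCompact.union hf hg).of_isClosed_subset (isClosed_supp _) (supp_add f g)
  smul_mem' c f hf := IsCompact.of_isClosed_subset hf (isClosed_supp _) (supp_smul c f)

/-- Compactly supported cochains whose coboundary is locally zero: these represent the cocycles of
the complex (compactly supported cochains)/(locally zero cochains). -/
def cocycles (X : Type*) [TopologicalSpace X] (p : ℕ) : Submodule ℂ (Cochain X p) :=
  compactlySupported X p ⊓ (locallyZero X (p + 1)).comap (coboundary X p)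

/-- Coboundaries of compactly supported cochains, up to locally zero cochains. -/
def coboundaries (X : Type*) [TopologicalSpace X] : (p : ℕ) → Submodule ℂ (Cochain X p)
  | 0 => locallyZero X 0
  | p + 1 => locallyZero X (p + 1) ⊔ (compactlySupported X p).map (coboundary X p)

/-- The compactly supported cohomology `H_c^p(X)` with complex coefficients. -/
abbrev Hc (X : Type*) [TopologicalSpace X] (p : ℕ) : Type _ :=
  ↥(cocycles X p) ⧸ (coboundaries X p).submoduleOf (cocycles X p)

/-! ### The representation of a group on `H_c^p(X)` -/

variable {Γ : Type*} [Group Γ] [MulAction Γ X]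

/-- The action of `γ` on cochains: `(γ f)(x₀,…,x_p) = f(γ⁻¹x₀,…,γ⁻¹x_p)`. -/
def translate (p : ℕ) (γ : Γ) : Cochain X p →ₗ[ℂ] Cochain X p where
  toFun f x := f (fun i => γ⁻¹ • x i)
  map_add' _ _ := rfl
  map_smul' _ _ := rfl

theorem translate_coboundary {Y : Type*} [MulAction Γ Y] (γ : Γ) (f : Cochain Y p) :
    coboundary Y p (translate p γ f) = translate (p + 1) γ (coboundary Y p f) := rfl

variable [ContinuousConstSMul Γ X]

theorem supp_translate (γ : Γ) (f : Cochain X p) :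
    supp (translate p γ f) = (fun x => γ⁻¹ • x) ⁻¹' supp f := by
  ext x
  refine not_congr ⟨?_, ?_⟩
  · rintro ⟨U, hU, h⟩
    refine ⟨(fun y => γ • y) ⁻¹' U, ?_, fun y hy => ?_⟩
    · refine (continuous_const_smul γ).continuousAt.preimage_mem_nhds ?_
      simpa using hU
    · have := h (fun i => γ • y i) hy
      simpa [translate] using this
  · rintro ⟨U, hU, h⟩
    refine ⟨(fun y => γ⁻¹ • y) ⁻¹' U, ?_, fun y hy => h _ hy⟩
    exact (continuous_const_smul γ⁻¹).continuousAt.preimage_mem_nhds hU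

theorem translate_mem_locallyZero (γ : Γ) {f : Cochain X p} (hf : f ∈ locallyZero X p) :
    translate p γ f ∈ locallyZero X p := by
  change supp _ = ∅
  change supp _ = ∅ at hf
  rw [supp_translate, hf, Set.preimage_empty]

theorem translate_mem_compactlySupported (γ : Γ) {f : Cochain X p}
    (hf : f ∈ compactlySupported X p) : translate p γ f ∈ compactlySupported X p := by
  change IsCompact (supp _)
  rw [supp_translate]
  exact (Homeomorph.smul (γ⁻¹ : Γ)).isCompact_preimage.2 hf

theorem translate_mem_cocycles (γ : Γ) {f : Cochain X p} (hf : f ∈ cocycles X p) :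
    translate p γ f ∈ cocycles X p :=
  ⟨translate_mem_compactlySupported γ hf.1, translate_mem_locallyZero γ hf.2⟩

theorem translate_mem_coboundaries (γ : Γ) {f : Cochain X p} (hf : f ∈ coboundaries X p) :
    translate p γ f ∈ coboundaries X p := by
  cases p with
  | zero => exact translate_mem_locallyZero γ hf
  | succ p =>
    obtain ⟨g, hg, _, ⟨k, hk, rfl⟩, rfl⟩ := Submodule.mem_sup.1 hf
    rw [map_add, ← translate_coboundary]
    exact Submodule.add_mem_sup (translate_mem_locallyZero γ hg)
      (Submodule.mem_map_of_mem (translate_mem_compactlySupported γ hk))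

/-- The representation of `Γ` on `H_c^p(X)`: the element `γ` acts by pulling back along `γ⁻¹`. -/
def HcRep (Γ X : Type*) [TopologicalSpace X] [Group Γ] [MulAction Γ X] [ContinuousConstSMul Γ X]
    (p : ℕ) : Representation ℂ Γ (Hc X p) where
  toFun γ := Submodule.mapQ _ _
    ((translate p γ).restrict fun _ hf => translate_mem_cocycles γ hf)
    fun _ hf => translate_mem_coboundaries γ hf
  map_one' := by
    refine LinearMap.ext fun v => ?_
    obtain ⟨f, rfl⟩ := Submodule.Quotient.mk_surjective _ v
    refine congrArg Submodule.Quotient.mk (Subtype.ext (funext fun x => ?_))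
    change f.1 (fun i => (1 : Γ)⁻¹ • x i) = f.1 x
    simp
  map_mul' γ γ' := by
    refine LinearMap.ext fun v => ?_
    obtain ⟨f, rfl⟩ := Submodule.Quotient.mk_surjective _ v
    refine congrArg Submodule.Quotient.mk (Subtype.ext (funext fun x => ?_))
    change f.1 (fun i => (γ * γ')⁻¹ • x i) = f.1 (fun i => γ'⁻¹ • γ⁻¹ • x i)
    simp [mul_smul]

variable {Δ : Type*} [Group Δ] [MulAction Δ X] [ContinuousConstSMul Δ X]

/-- The isotypic component `H_c^p(X)_χ = {v | δ v = χ(δ) v for all δ ∈ Δ}`. -/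
def isotypic (X : Type*) [TopologicalSpace X] [MulAction Δ X] [ContinuousConstSMul Δ X]
    (p : ℕ) (χ : Δ →* ℂˣ) : Submodule ℂ (Hc X p) where
  carrier := {v | ∀ δ : Δ, HcRep Δ X p δ v = (χ δ : ℂ) • v}
  zero_mem' δ := by simp
  add_mem' {v w} hv hw δ := by simp [hv δ, hw δ]
  smul_mem' c v hv δ := by rw [map_smul, hv δ, smul_comm]

theorem HcRep_comm [SMulCommClass Γ Δ X] (γ : Γ) (δ : Δ) (v : Hc X p) :
    HcRep Γ X p γ (HcRep Δ X p δ v) = HcRep Δ X p δ (HcRep Γ X p γ v) := by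
  obtain ⟨f, rfl⟩ := Submodule.Quotient.mk_surjective _ v
  refine congrArg Submodule.Quotient.mk (Subtype.ext (funext fun x => ?_))
  change f.1 (fun i => δ⁻¹ • γ⁻¹ • x i) = f.1 (fun i => γ⁻¹ • δ⁻¹ • x i)
  simp only [smul_comm]

theorem HcRep_mem_isotypic [SMulCommClass Γ Δ X] (γ : Γ) (χ : Δ →* ℂˣ) (v : Hc X p)
    (hv : v ∈ isotypic X p χ) : HcRep Γ X p γ v ∈ isotypic X p χ := fun δ => by
  rw [← HcRep_comm, hv δ, map_smul]

end Cohomology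

/-! ### Equivariant weight polynomials -/

section WeightPolynomials

variable {σ : Type*}

/-- The dimension of a variety `X ⊆ ℂ^σ` (locally closed in the Zariski topology): the Krull
dimension of `ℂ[σ]/I(X)`, the coordinate ring of the Zariski closure of `X`. -/
def dim (X : Set (σ → ℂ)) : ℕ :=
  ((ringKrullDim (MvPolynomial σ ℂ ⧸ MvPolynomial.vanishingIdeal ℂ X)).unbotD 0).toNat

/-- The formal sum `∑ᵢ aᵢ q^{i-d}` over all `i ≥ 0`, as an element of `ℂ((q))`. -/
def shiftedSum (d : ℕ) (a : ℕ → ℂ) : LaurentSeries ℂ :=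
  HahnSeries.single (-(d : ℤ)) (1 : ℂ) * HahnSeries.ofPowerSeries ℤ ℂ (PowerSeries.mk a)

/-- `P(γ, X, q) = ∑ᵢ (-1)ⁱ tr(γ, H_c^i(X)) q^{i - dim X}`. -/
def weightPoly {Γ : Type*} [Group Γ] (γ : Γ) (X : Set (σ → ℂ)) [MulAction Γ X]
    [ContinuousConstSMul Γ X] : LaurentSeries ℂ :=
  shiftedSum (dim X) fun i => (-1) ^ i * LinearMap.trace ℂ (Hc X i) (HcRep Γ X i γ)

/-- `P(γ, χ, X, q) = ∑ᵢ (-1)ⁱ tr(γ, H_c^i(X)_χ) q^{i - dim X}`, for commuting actions of `Γ` and of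
an abelian group `Δ` on `X` and a character `χ` of `Δ`. -/
def isotypicWeightPoly {Γ Δ : Type*} [Group Γ] [CommGroup Δ] (γ : Γ) (χ : Δ →* ℂˣ)
    (X : Set (σ → ℂ)) [MulAction Γ X] [ContinuousConstSMul Γ X] [MulAction Δ X]
    [ContinuousConstSMul Δ X] [SMulCommClass Γ Δ X] : LaurentSeries ℂ :=
  shiftedSum (dim X) fun i => (-1) ^ i * LinearMap.trace ℂ (isotypic X i χ)
    ((HcRep Γ X i γ).restrict (HcRep_mem_isotypic γ χ))

end WeightPolynomials

/-! ### The variety `T(r,m)` and the action of the wreath product -/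

section Torus

variable {r m : ℕ}

/-- `T(r,m) = {z ∈ ℂ^m | zᵢ ≠ 0 for all i, zᵢ^r ≠ zⱼ^r for all i ≠ j}`. -/
def T (r m : ℕ) : Set (Fin m → ℂ) :=
  {z | (∀ i, z i ≠ 0) ∧ ∀ i j, i ≠ j → z i ^ r ≠ z j ^ r}

/-- The wreath product `W(r,m) = μ_r^m ⋊ S_m`, in which `w ∈ S_m` conjugates `ζ ∈ μ_r^m` to
`i ↦ ζ_{w⁻¹(i)}`. -/
abbrev W (r m : ℕ) : Type :=
  (Fin m → rootsOfUnity r ℂ) ⋊[mulAutArrow] Equiv.Perm (Fin m)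

instance [NeZero r] : Fintype (rootsOfUnity r ℂ) := Fintype.ofFinite _

theorem rootsOfUnity_pow (ζ : rootsOfUnity r ℂ) : ((ζ : ℂˣ) : ℂ) ^ r = 1 := by
  have h := congrArg Units.val ((mem_rootsOfUnity r (ζ : ℂˣ)).1 ζ.2)
  rwa [Units.val_pow_eq_pow_val, Units.val_one] at h

/-- `S_m` permutes the coordinates and `μ_r^m` scales them: `(ζ w)·z = (i ↦ ζᵢ z_{w⁻¹(i)})`. -/
instance : MulAction (W r m) (T r m) where
  smul g z := ⟨fun i => ((g.left i : ℂˣ) : ℂ) * z.1 (g.right⁻¹ i),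
    fun i => mul_ne_zero (Units.ne_zero _) (z.2.1 _), fun i j hij => by
      rw [mul_pow, mul_pow, rootsOfUnity_pow, rootsOfUnity_pow, one_mul, one_mul]
      exact z.2.2 _ _ fun h => hij (g.right⁻¹.injective h)⟩
  one_smul z := Subtype.ext (funext fun i => by
    change (((1 : W r m).left i : ℂˣ) : ℂ) * z.1 ((1 : W r m).right⁻¹ i) = z.1 i
    simp)
  mul_smul g h z := Subtype.ext (funext fun i => by
    change (((g * h).left i : ℂˣ) : ℂ) * z.1 ((g * h).right⁻¹ i) =
      ((g.left i : ℂˣ) : ℂ) * (((h.left (g.right⁻¹ i) : ℂˣ) : ℂ) * z.1 (h.right⁻¹ (g.right⁻¹ i)))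
    rw [SemidirectProduct.mul_left, SemidirectProduct.mul_right, mul_inv_rev, ← mul_assoc]
    rfl)

theorem W_smul_apply (g : W r m) (z : T r m) (i : Fin m) :
    (g • z).1 i = ((g.left i : ℂˣ) : ℂ) * z.1 (g.right⁻¹ i) := rfl

instance : ContinuousConstSMul (W r m) (T r m) where
  continuous_const_smul g := by
    refine Continuous.subtype_mk (continuous_pi fun i => ?_) _
    exact continuous_const.mul ((continuous_apply _).comp continuous_subtype_val)

end Torus

/-! ### The variety `T^{(n)}(1,m)` and its commuting actions of `S_m` and `μ_n` -/

section Cover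

variable {n m : ℕ}

/-- `T^{(n)}(1,m) = {((zᵢ), z) ∈ T(1,m) × ℂˣ | zⁿ = z₁⋯z_m}`, as a subset of `ℂ^{m+1}`; the
coordinate `some i` is `zᵢ` and the coordinate `none` is `z`. -/
def Tcover (n m : ℕ) : Set (Option (Fin m) → ℂ) :=
  {x | (fun i => x (some i)) ∈ T 1 m ∧ x none ≠ 0 ∧ x none ^ n = ∏ i, x (some i)}

/-- `S_m` permutes the coordinates `zᵢ`: `w·((zᵢ), z) = ((z_{w⁻¹(i)}), z)`. -/
instance : MulAction (Equiv.Perm (Fin m)) (Tcover n m) where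
  smul w x := ⟨fun o => x.1 (o.map (w⁻¹ : Equiv.Perm (Fin m))),
    ⟨fun i => x.2.1.1 (w⁻¹ i), fun i j hij => x.2.1.2 _ _ fun h => hij (w⁻¹.injective h)⟩,
    x.2.2.1, x.2.2.2.trans (Equiv.prod_comp w⁻¹ fun i => x.1 (some i)).symm⟩
  one_smul x := Subtype.ext (funext fun o => by cases o <;> rfl)
  mul_smul w w' x := Subtype.ext (funext fun o => by cases o <;> rfl)

/-- `μ_n` scales `z`: `ζ·((zᵢ), z) = ((zᵢ), ζ z)`. -/
instance : MulAction (rootsOfUnity n ℂ) (Tcover n m) where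
  smul ζ x := ⟨fun o => o.elim (((ζ : ℂˣ) : ℂ) * x.1 none) fun i => x.1 (some i),
    x.2.1, mul_ne_zero (Units.ne_zero _) x.2.2.1, by
      change (((ζ : ℂˣ) : ℂ) * x.1 none) ^ n = ∏ i, x.1 (some i)
      rw [mul_pow, rootsOfUnity_pow, one_mul, x.2.2.2]⟩
  one_smul x := Subtype.ext (funext fun o => by
    cases o with
    | none => exact one_mul _
    | some i => rfl)
  mul_smul ζ ζ' x := Subtype.ext (funext fun o => by
    cases o with
    | none => exact mul_assoc _ _ _
    | some i => rfl)

instance : ContinuousConstSMul (Equiv.Perm (Fin m)) (Tcover n m) where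
  continuous_const_smul _ := by
    refine Continuous.subtype_mk (continuous_pi fun o => ?_) _
    exact (continuous_apply _).comp continuous_subtype_val

instance : ContinuousConstSMul (rootsOfUnity n ℂ) (Tcover n m) where
  continuous_const_smul ζ := by
    refine Continuous.subtype_mk (continuous_pi fun o => ?_) _
    cases o with
    | none => exact continuous_const.mul ((continuous_apply _).comp continuous_subtype_val)
    | some i => exact (continuous_apply _).comp continuous_subtype_val

instance : SMulCommClass (Equiv.Perm (Fin m)) (rootsOfUnity n ℂ) (Tcover n m) where
  smul_comm _ _ _ := Subtype.ext (funext fun o => by cases o <;> rfl)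

end Cover

end WeightPoly

end

noncomputable section

namespace WeightPoly

/-! ### Operations on cochains -/

section Cochains

variable {X Y Z : Type*} {p : ℕ}

/-! The map `z ↦ ((zᵢⁿ), z₁⋯z_m)` from `T(n,m)` to `T^{(n)}(1,m)` is a finite free quotient by the
kernel `K` of the product map `μ_n^m → μ_n` (`isFreeQuotient_coverMap`). It intertwines `ζ w` with
the action of `∏ ζᵢ` and `w` (`coverMap_smul`). Averaging over `K` shows that pullback on `H_c` is
injective with image containing all `K`-invariant classes (`IsFreeQuotient.map_injective`,
`IsFreeQuotient.mem_range_map`). The `χ⁻¹`-part of `H_c(T^{(n)}(1,m))` thus becomes the subspace of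
`H_c(T(n,m))` on which `μ_n^m` acts through `χ⁻¹` of the product. The operator `n^{-m} ∑ χ(∏ ζᵢ) w
ζ` maps into this subspace and acts there as `w`, so its trace is the trace of `w` on the isotypic
part (`trace_isotypic_eq`).

Comparing these traces needs `H_c(T(n,m))` to be finite dimensional (`FiniteHc.T`). As `T(n,m)` is
the complement of finitely many linear subspaces, this follows by removing them one at a time
(`FiniteHc.compl`), starting from real vector spaces. Those are handled by the vanishing of `H_c` of
a half-space. All of this is done on Alexander–Spanier cochains with a prism homotopy
(`coboundary_prism_add`).

Finally, both varieties have the same dimension, since one coordinate ring is integral over the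
other (`dim_T_eq_dim_Tcover`). The powers of `q` therefore match, and the identity can be checked
coefficient by coefficient. -/

theorem coboundary_apply (f : Cochain X p) (x : Fin (p + 2) → X) :
    coboundary X p f x =
      ∑ j : Fin (p + 2), (-1 : ℂ) ^ (j : ℕ) * f (fun i => x (j.succAbove i)) := rfl

/-- Pullback of cochains along an arbitrary function. -/
def pullback (φ : X → Y) (p : ℕ) : Cochain Y p →ₗ[ℂ] Cochain X p where
  toFun f x := f fun i => φ (x i)
  map_add' _ _ := rfl
  map_smul' _ _ := rfl

theorem pullback_apply (φ : X → Y) (f : Cochain Y p) (x : Fin (p + 1) → X) :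
    pullback φ p f x = f fun i => φ (x i) := rfl

theorem coboundary_pullback (φ : X → Y) (f : Cochain Y p) :
    coboundary X p (pullback φ p f) = pullback φ (p + 1) (coboundary Y p f) := rfl

/-- Evaluation of the first variable of a cochain at `y`. -/
def contract (y : X) (p : ℕ) : Cochain X (p + 1) →ₗ[ℂ] Cochain X p where
  toFun f x := f (Fin.cons y x)
  map_add' _ _ := rfl
  map_smul' _ _ := rfl

theorem contract_apply (y : X) (f : Cochain X (p + 1)) (x : Fin (p + 1) → X) :
    contract y p f x = f (Fin.cons y x) := rfl

/-- Fixing the first variable lowers the degree without losing information, so cochain identities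
can be proved by induction on the degree. -/
theorem contract_ext {f g : Cochain X (p + 1)} (h : ∀ y, contract y p f = contract y p g) :
    f = g := by
  funext x
  have := congrFun (h (x 0)) (Fin.tail x)
  simpa only [contract_apply, Fin.cons_self_tail] using this

theorem contract_pullback (φ : X → Y) (f : Cochain Y (p + 1)) (x : X) :
    contract x p (pullback φ (p + 1) f) = pullback φ p (contract (φ x) p f) := by
  funext z
  simp only [contract_apply, pullback_apply]
  congr 1
  funext i
  cases i using Fin.cases <;> simp

theorem contract_coboundary_zero (y : X) (f : Cochain X 0) :
    contract y 0 (coboundary X 0 f) = f - fun _ => f fun _ => y := by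
  funext x
  have h1 : (fun i : Fin 1 => (Fin.cons y x : Fin 2 → X) (Fin.succAbove 0 i)) = x := by
    funext i; simp
  have h2 : (fun i : Fin 1 => (Fin.cons y x : Fin 2 → X) (Fin.succAbove 1 i)) = fun _ => y := by
    funext i
    fin_cases i
    rfl
  rw [contract_apply, coboundary_apply, Fin.sum_univ_two, h1, h2]
  simp [sub_eq_add_neg]

/-- Omitting the inserted `y` returns `f`; omitting any other variable shifts the index by one and
so flips the sign. Before supports are imposed, contraction is a contracting homotopy. -/
theorem contract_coboundary (y : X) (f : Cochain X (p + 1)) :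
    contract y (p + 1) (coboundary X (p + 1) f) = f - coboundary X p (contract y p f) := by
  funext x
  rw [contract_apply, coboundary_apply, Fin.sum_univ_succ]
  simp only [Pi.sub_apply, sub_eq_add_neg]
  congr 1
  · simp
  · rw [coboundary_apply, ← Finset.sum_neg_distrib]
    refine Finset.sum_congr rfl fun j _ => ?_
    have h : (fun i => (Fin.cons y x : Fin (p + 3) → X) (j.succ.succAbove i)) =
        Fin.cons y fun i => x (j.succAbove i) := by
      funext i
      cases i using Fin.cases <;> simp
    rw [h, contract_apply, Fin.val_succ, pow_succ]
    ring

theorem coboundary_coboundary (f : Cochain X p) :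
    coboundary X (p + 1) (coboundary X p f) = 0 := by
  induction p with
  | zero =>
    refine contract_ext fun y => ?_
    rw [contract_coboundary, contract_coboundary_zero, map_sub, sub_sub_cancel, map_zero]
    funext x
    simp [coboundary_apply]
  | succ p ih =>
    refine contract_ext fun y => ?_
    rw [contract_coboundary, contract_coboundary, map_sub, ih, sub_zero, sub_self, map_zero]

/-- The prism operator attached to two functions `φ` and `ψ`. -/
def prism (φ ψ : X → Y) : (p : ℕ) → Cochain Y (p + 1) →ₗ[ℂ] Cochain X p
  | 0 =>
    { toFun f x := f (Fin.cons (φ (x 0)) fun i => ψ (x i))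
      map_add' _ _ := rfl
      map_smul' _ _ := rfl }
  | p + 1 =>
    -- Unrolled, this is the alternating sum of `f (φ x₀, …, φ xⱼ, ψ xⱼ, …, ψ x_p)`.
    { toFun f x := f (Fin.cons (φ (x 0)) fun i => ψ (x i)) -
        prism φ ψ p (contract (φ (x 0)) (p + 1) f) (Fin.tail x)
      map_add' f g := by
        funext x
        simp only [map_add, Pi.add_apply]
        ring
      map_smul' c f := by
        funext x
        simp only [map_smul, Pi.smul_apply, smul_eq_mul, RingHom.id_apply]
        ring }

theorem prism_zero_apply (φ ψ : X → Y) (f : Cochain Y 1) (x : Fin 1 → X) :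
    prism φ ψ 0 f x = f (Fin.cons (φ (x 0)) fun i => ψ (x i)) := rfl

theorem prism_succ_apply (φ ψ : X → Y) (f : Cochain Y (p + 2)) (x : Fin (p + 2) → X) :
    prism φ ψ (p + 1) f x = f (Fin.cons (φ (x 0)) fun i => ψ (x i)) -
      prism φ ψ p (contract (φ (x 0)) (p + 1) f) (Fin.tail x) := rfl

theorem contract_prism (φ ψ : X → Y) (f : Cochain Y (p + 2)) (x : X) :
    contract x p (prism φ ψ (p + 1) f) =
      pullback ψ p (contract (ψ x) p (contract (φ x) (p + 1) f)) -
        prism φ ψ p (contract (φ x) (p + 1) f) := by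
  rw [← contract_pullback]
  rfl

theorem prism_coboundary_zero (φ ψ : X → Y) (f : Cochain Y 0) :
    prism φ ψ 0 (coboundary Y 0 f) = pullback ψ 0 f - pullback φ 0 f := by
  funext x
  have h := congrFun (contract_coboundary_zero (φ (x 0)) f) fun i => ψ (x i)
  rw [contract_apply] at h
  rw [prism_zero_apply, h]
  simp only [Pi.sub_apply, pullback_apply]
  congr 2
  funext i
  fin_cases i
  rfl

/-- The prism operator is a chain homotopy between the pullbacks along `φ` and `ψ`. -/
theorem coboundary_prism_add (φ ψ : X → Y) (f : Cochain Y (p + 1)) :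
    coboundary X p (prism φ ψ p f) + prism φ ψ (p + 1) (coboundary Y (p + 1) f) =
      pullback ψ (p + 1) f - pullback φ (p + 1) f := by
  induction p with
  | zero =>
    refine contract_ext fun x => ?_
    rw [map_add, map_sub, contract_coboundary_zero, contract_prism, contract_coboundary,
      map_sub, map_sub, map_sub, prism_coboundary_zero, contract_pullback,
      contract_pullback, contract_coboundary_zero]
    funext z
    simp only [Pi.add_apply, Pi.sub_apply, pullback_apply, contract_apply, prism_zero_apply]
    ring
  | succ p ih =>
    refine contract_ext fun x => ?_
    have h := ih (contract (φ x) (p + 1) f)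
    rw [map_add, map_sub, contract_coboundary, contract_prism, contract_prism,
      contract_coboundary, map_sub, map_sub, map_sub, map_sub, contract_coboundary,
      contract_pullback, contract_pullback, map_sub, coboundary_pullback]
    linear_combination h

/-- The prism operator evaluates `f` only at tuples formed from the points `φ (x i)` and `ψ (x i)`.
-/
theorem prism_apply_eq_zero (φ ψ : X → Y) {f : Cochain Y (p + 1)} {V : Set Y}
    (hf : ∀ y, (∀ i, y i ∈ V) → f y = 0) {x : Fin (p + 1) → X} (hφ : ∀ i, φ (x i) ∈ V)
    (hψ : ∀ i, ψ (x i) ∈ V) : prism φ ψ p f x = 0 := by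
  have key : f (Fin.cons (φ (x 0)) fun i => ψ (x i)) = 0 :=
    hf _ fun i => by cases i using Fin.cases <;> simp [hφ, hψ]
  induction p with
  | zero => exact key
  | succ p ih =>
    have hc : ∀ y, (∀ i, y i ∈ V) → contract (φ (x 0)) (p + 1) f y = 0 := fun y hy =>
      hf _ fun i => by cases i using Fin.cases <;> simp [hφ, hy]
    rw [prism_succ_apply, key, ih hc (x := Fin.tail x) (fun i => hφ _) (fun i => hψ _), sub_zero]
    exact hc _ fun i => by cases i using Fin.cases <;> simp [hφ, hψ, Fin.tail]

/-- Every term of the prism operator has `φ (x 0)` as first argument. This is why cutoffs are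
imposed on the first variable only. -/
theorem prism_apply_eq_zero_of_notMem (φ ψ : X → Y) {f : Cochain Y (p + 1)} {K : Set Y}
    (hf : ∀ y, y 0 ∉ K → f y = 0) {x : Fin (p + 1) → X} (hx : φ (x 0) ∉ K) :
    prism φ ψ p f x = 0 := by
  have key : f (Fin.cons (φ (x 0)) fun i => ψ (x i)) = 0 := hf _ (by simpa using hx)
  cases p with
  | zero => exact key
  | succ p =>
    have hc : contract (φ (x 0)) (p + 1) f = 0 := funext fun y => hf _ (by simpa using hx)
    rw [prism_succ_apply, key, hc, map_zero, Pi.zero_apply, sub_zero]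

end Cochains

/-! ### Supports, and functoriality of `H_c` for proper maps -/

section Support

variable {X Y : Type*} [TopologicalSpace X] [TopologicalSpace Y] {p : ℕ}

theorem notMem_supp {f : Cochain X p} {x : X} :
    x ∉ supp f ↔ ∃ U ∈ 𝓝 x, ∀ y : Fin (p + 1) → X, (∀ i, y i ∈ U) → f y = 0 :=
  not_not

theorem mem_locallyZero {f : Cochain X p} : f ∈ locallyZero X p ↔ ∀ x, x ∉ supp f :=
  Set.eq_empty_iff_forall_notMem

theorem mem_compactlySupported {f : Cochain X p} :
    f ∈ compactlySupported X p ↔ IsCompact (supp f) := Iff.rfl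

theorem mem_cocycles {f : Cochain X p} :
    f ∈ cocycles X p ↔ IsCompact (supp f) ∧ coboundary X p f ∈ locallyZero X (p + 1) := Iff.rfl

theorem locallyZero_le_compactlySupported : locallyZero X p ≤ compactlySupported X p :=
  fun f hf => by
    rw [mem_compactlySupported, show supp f = ∅ from hf]
    exact isCompact_empty

theorem supp_subset_of_forall_notMem {f : Cochain X p} {K : Set X} (hK : IsClosed K)
    (h : ∀ y, y 0 ∉ K → f y = 0) : supp f ⊆ K := fun x hx => by
  by_contra hxK
  exact hx ⟨Kᶜ, hK.isOpen_compl.mem_nhds hxK, fun y hy => h y (hy 0)⟩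

theorem compactlySupported_of_forall_notMem [T2Space X] {f : Cochain X p} {K : Set X}
    (hK : IsCompact K) (h : ∀ y, y 0 ∉ K → f y = 0) : f ∈ compactlySupported X p :=
  hK.of_isClosed_subset (isClosed_supp f) (supp_subset_of_forall_notMem hK.isClosed h)

theorem supp_sub (f g : Cochain X p) : supp (f - g) ⊆ supp f ∪ supp g := by
  have h := supp_add f ((-1 : ℂ) • g)
  rw [neg_one_smul, ← sub_eq_add_neg] at h
  refine h.trans (Set.union_subset_union_right _ ?_)
  rw [← neg_one_smul ℂ g]
  exact supp_smul _ _

theorem supp_coboundary (f : Cochain X p) : supp (coboundary X p f) ⊆ supp f := fun x hx => by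
  by_contra h
  obtain ⟨U, hU, hf⟩ := notMem_supp.1 h
  refine hx ⟨U, hU, fun y hy => ?_⟩
  rw [coboundary_apply]
  exact Finset.sum_eq_zero fun j _ => by rw [hf _ fun i => hy _, mul_zero]

theorem coboundary_mem_locallyZero {f : Cochain X p} (hf : f ∈ locallyZero X p) :
    coboundary X p f ∈ locallyZero X (p + 1) :=
  mem_locallyZero.2 fun x hx => mem_locallyZero.1 hf x (supp_coboundary f hx)

theorem coboundary_mem_compactlySupported {f : Cochain X p} (hf : f ∈ compactlySupported X p) :
    coboundary X p f ∈ compactlySupported X (p + 1) :=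
  IsCompact.of_isClosed_subset hf (isClosed_supp _) (supp_coboundary f)

theorem locallyZero_le_coboundaries : locallyZero X p ≤ coboundaries X p := by
  cases p with
  | zero => exact le_rfl
  | succ p => exact le_sup_left

theorem coboundary_mem_coboundaries {f : Cochain X p} (hf : f ∈ compactlySupported X p) :
    coboundary X p f ∈ coboundaries X (p + 1) :=
  Submodule.mem_sup_right (Submodule.mem_map_of_mem hf)

theorem mem_coboundaries_succ {f : Cochain X (p + 1)} : f ∈ coboundaries X (p + 1) ↔
    ∃ g ∈ compactlySupported X p, f - coboundary X p g ∈ locallyZero X (p + 1) := by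
  constructor
  · intro hf
    obtain ⟨k, hk, _, ⟨g, hg, rfl⟩, rfl⟩ := Submodule.mem_sup.1 hf
    exact ⟨g, hg, by rwa [add_sub_cancel_right]⟩
  · rintro ⟨g, hg, h⟩
    rw [← sub_add_cancel f (coboundary X p g)]
    exact add_mem (locallyZero_le_coboundaries h) (coboundary_mem_coboundaries hg)

/-- The class in `H_c^p(X)` of a cocycle. -/
abbrev Hc.mk (X : Type*) [TopologicalSpace X] (p : ℕ) : cocycles X p →ₗ[ℂ] Hc X p :=
  Submodule.mkQ _

theorem Hc.mk_eq_zero {f : cocycles X p} : Hc.mk X p f = 0 ↔ f.1 ∈ coboundaries X p :=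
  Submodule.Quotient.mk_eq_zero _

theorem Hc.mk_eq_mk {f g : cocycles X p} :
    Hc.mk X p f = Hc.mk X p g ↔ f.1 - g.1 ∈ coboundaries X p :=
  Submodule.Quotient.eq _

theorem Hc.mk_surjective : Function.Surjective (Hc.mk X p) := Submodule.mkQ_surjective _

/-- A compactly supported cochain can be changed by a locally zero one so as to vanish as soon as
its first variable lies outside a suitable compact neighbourhood of the support. -/
theorem exists_cutoff [LocallyCompactSpace X] (f : Cochain X p)
    (hf : IsCompact (supp f)) {U : Set X} (hU : IsOpen U) (hfU : supp f ⊆ U) :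
    ∃ (g : Cochain X p) (K : Set X), IsCompact K ∧ K ⊆ U ∧ f - g ∈ locallyZero X p ∧
      ∀ y, y 0 ∉ K → g y = 0 := by
  classical
  obtain ⟨K, hK, hfK, hKU⟩ := exists_compact_between hf hU hfU
  refine ⟨fun y => if y 0 ∈ K then f y else 0, K, hK, hKU, ?_, fun y hy => if_neg hy⟩
  refine mem_locallyZero.2 fun x => ?_
  -- On the support, `K` is a neighbourhood and the cutoff changes nothing nearby; off it, `f`
  -- already vanishes locally.
  by_cases hx : x ∈ supp f
  · refine notMem_supp.2 ⟨K, mem_interior_iff_mem_nhds.1 (hfK hx), fun y hy => ?_⟩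
    simp [hy 0]
  · obtain ⟨V, hV, hfV⟩ := notMem_supp.1 hx
    refine notMem_supp.2 ⟨V, hV, fun y hy => ?_⟩
    simp [hfV y hy]

theorem supp_pullback_subset {φ : X → Y} (hφ : Continuous φ) (f : Cochain Y p) :
    supp (pullback φ p f) ⊆ φ ⁻¹' supp f := fun x hx => by
  by_contra h
  obtain ⟨U, hU, hf⟩ := notMem_supp.1 h
  exact hx ⟨φ ⁻¹' U, hφ.continuousAt.preimage_mem_nhds hU, fun y hy => hf _ hy⟩

theorem supp_pullback {φ : X → Y} (hφ : Continuous φ) (hφ' : IsOpenMap φ) (f : Cochain Y p) :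
    supp (pullback φ p f) = φ ⁻¹' supp f := by
  refine (supp_pullback_subset hφ f).antisymm fun x hx => ?_
  by_contra h
  obtain ⟨U, hU, hf⟩ := notMem_supp.1 h
  refine hx ⟨φ '' U, hφ'.image_mem_nhds hU, fun y hy => ?_⟩
  choose z hz hzy using hy
  simpa only [pullback_apply, hzy] using hf z hz

theorem pullback_mem_locallyZero {φ : X → Y} (hφ : Continuous φ) {f : Cochain Y p}
    (hf : f ∈ locallyZero Y p) : pullback φ p f ∈ locallyZero X p :=
  mem_locallyZero.2 fun _ hx => mem_locallyZero.1 hf _ (supp_pullback_subset hφ f hx)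

theorem pullback_mem_compactlySupported {φ : X → Y} (hφ : IsProperMap φ) {f : Cochain Y p}
    (hf : f ∈ compactlySupported Y p) : pullback φ p f ∈ compactlySupported X p :=
  (hφ.isCompact_preimage hf).of_isClosed_subset (isClosed_supp _)
    (supp_pullback_subset hφ.continuous f)

theorem pullback_mem_cocycles {φ : X → Y} (hφ : IsProperMap φ) {f : Cochain Y p}
    (hf : f ∈ cocycles Y p) : pullback φ p f ∈ cocycles X p :=
  ⟨pullback_mem_compactlySupported hφ hf.1, pullback_mem_locallyZero hφ.continuous hf.2⟩

theorem pullback_mem_coboundaries {φ : X → Y} (hφ : IsProperMap φ) {f : Cochain Y p}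
    (hf : f ∈ coboundaries Y p) : pullback φ p f ∈ coboundaries X p := by
  cases p with
  | zero => exact pullback_mem_locallyZero hφ.continuous hf
  | succ p =>
    obtain ⟨g, hg, h⟩ := mem_coboundaries_succ.1 hf
    exact mem_coboundaries_succ.2 ⟨pullback φ p g, pullback_mem_compactlySupported hφ hg,
      pullback_mem_locallyZero hφ.continuous h⟩

/-- The map `H_c^p(Y) → H_c^p(X)` induced by a proper map `X → Y`. -/
def Hc.map (φ : X → Y) (hφ : IsProperMap φ) (p : ℕ) : Hc Y p →ₗ[ℂ] Hc X p :=
  Submodule.mapQ _ _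
    ((pullback φ p).restrict fun _ hf => pullback_mem_cocycles hφ hf)
    fun _ hf => pullback_mem_coboundaries hφ hf

theorem Hc.map_mk (φ : X → Y) (hφ : IsProperMap φ) (f : cocycles Y p) :
    Hc.map φ hφ p (Hc.mk Y p f) =
      Hc.mk X p ⟨pullback φ p f.1, pullback_mem_cocycles hφ f.2⟩ := rfl

end Support

/-! ### Spaces with finite dimensional `H_c` -/

section Finite

/-- All `H_c^p(X)` are finite dimensional. -/
def FiniteHc (X : Type*) [TopologicalSpace X] : Prop := ∀ p, Module.Finite ℂ (Hc X p)

theorem FiniteHc.of_homeomorph {X Y : Type*} [TopologicalSpace X] [TopologicalSpace Y]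
    (h : FiniteHc X) (e : X ≃ₜ Y) : FiniteHc Y := fun p => by
  have := h p
  refine Module.Finite.of_surjective (Hc.map e.symm e.symm.isProperMap p) fun v => ?_
  obtain ⟨f, rfl⟩ := Hc.mk_surjective v
  refine ⟨Hc.mk X p ⟨_, pullback_mem_cocycles e.isProperMap f.2⟩, ?_⟩
  rw [Hc.map_mk]
  congr 1
  refine Subtype.ext (funext fun x => ?_)
  simp [pullback_apply]

theorem FiniteHc.of_finite (X : Type*) [TopologicalSpace X] [Finite X] : FiniteHc X := fun p => by
  have : Module.Finite ℂ (Cochain X p) := inferInstance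
  infer_instance

end Finite

/-! ### Finiteness for the complement of a closed subset -/

/-- `F` factors through `A ⧸ ker T`, which embeds in `N`. It extracts finiteness from exactness
while working with infinite-dimensional spaces of cochains `A`. -/
theorem finite_range_of_ker_le {A M N : Type*} [AddCommGroup A] [AddCommGroup M] [AddCommGroup N]
    [Module ℂ A] [Module ℂ M] [Module ℂ N] [Module.Finite ℂ N] (F : A →ₗ[ℂ] M) (T : A →ₗ[ℂ] N)
    (h : ∀ a, T a = 0 → F a = 0) : Module.Finite ℂ (LinearMap.range F) := by
  have h1 : Module.Finite ℂ (A ⧸ LinearMap.ker T) :=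
    Module.Finite.equiv T.quotKerEquivRange.symm
  rw [← (LinearMap.ker T).range_liftQ F (fun a ha => h a ha)]
  infer_instance

section Complement

variable {X : Type*} [TopologicalSpace X] {p : ℕ}

/-- Cochains with compact support contained in `U`. -/
def supportedIn (U : Set X) (p : ℕ) : Submodule ℂ (Cochain X p) where
  carrier := {f | IsCompact (supp f) ∧ supp f ⊆ U}
  zero_mem' := by
    rw [Set.mem_ofPred_eq, supp_zero]
    exact ⟨isCompact_empty, Set.empty_subset _⟩
  add_mem' {f g} hf hg := ⟨(compactlySupported X p).add_mem hf.1 hg.1,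
    (supp_add f g).trans (Set.union_subset hf.2 hg.2)⟩
  smul_mem' c f hf := ⟨(compactlySupported X p).smul_mem c hf.1, (supp_smul c f).trans hf.2⟩

theorem pullback_val_mem_compactlySupported {U : Set X} (hU : IsOpen U) {f : Cochain X p}
    (hf : f ∈ supportedIn U p) :
    pullback (Subtype.val : U → X) p f ∈ compactlySupported U p := by
  rw [mem_compactlySupported, supp_pullback continuous_subtype_val hU.isOpenMap_subtype_val]
  refine Topology.IsInducing.subtypeVal.isCompact_preimage' hf.1 ?_
  rw [Subtype.range_coe]
  exact hf.2

/-- Every compactly supported cochain on an open subset `U` agrees, up to a locally zero one, with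
the restriction of a cochain with compact support in `U`. -/
theorem exists_extension_of_isOpen [T2Space X] [LocallyCompactSpace X] {U : Set X}
    (hU : IsOpen U) {f : Cochain U p} (hf : f ∈ compactlySupported U p) :
    ∃ g ∈ supportedIn U p, f - pullback Subtype.val p g ∈ locallyZero U p := by
  classical
  have := hU.locallyCompactSpace
  obtain ⟨f', K, hK, -, hff', hf'⟩ := exists_cutoff f hf isOpen_univ (Set.subset_univ _)
  let g : Cochain X p := fun y => if h : ∀ i, y i ∈ U then f' fun i => ⟨y i, h i⟩ else 0
  have hgK : ∀ y, y 0 ∉ (Subtype.val '' K : Set X) → g y = 0 := fun y hy => by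
    by_cases h : ∀ i, y i ∈ U
    · simp only [g, dif_pos h]
      exact hf' _ fun h0 => hy ⟨_, h0, rfl⟩
    · simp only [g, dif_neg h]
  have hK' : IsCompact (Subtype.val '' K : Set X) := hK.image continuous_subtype_val
  refine ⟨g, ⟨compactlySupported_of_forall_notMem hK' hgK, ?_⟩, ?_⟩
  · refine (supp_subset_of_forall_notMem hK'.isClosed hgK).trans ?_
    rintro _ ⟨x, -, rfl⟩
    exact x.2
  · convert hff' using 2
    funext y
    simp [g, pullback_apply]

/-- Every compactly supported cochain on a closed subset `Z` agrees, up to a locally zero one, with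
the restriction of a compactly supported cochain. -/
theorem exists_extension_of_isClosed [T2Space X] [LocallyCompactSpace X] {Z : Set X}
    (hZ : IsClosed Z) {f : Cochain Z p} (hf : f ∈ compactlySupported Z p) :
    ∃ g ∈ compactlySupported X p, f - pullback Subtype.val p g ∈ locallyZero Z p := by
  classical
  have := hZ.locallyCompactSpace
  obtain ⟨f', K, hK, -, hff', hf'⟩ := exists_cutoff f hf isOpen_univ (Set.subset_univ _)
  let g : Cochain X p := fun y => if h : ∀ i, y i ∈ Z then f' fun i => ⟨y i, h i⟩ else 0
  have hgK : ∀ y, y 0 ∉ (Subtype.val '' K : Set X) → g y = 0 := fun y hy => by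
    by_cases h : ∀ i, y i ∈ Z
    · simp only [g, dif_pos h]
      exact hf' _ fun h0 => hy ⟨_, h0, rfl⟩
    · simp only [g, dif_neg h]
  refine ⟨g, compactlySupported_of_forall_notMem (hK.image continuous_subtype_val) hgK, ?_⟩
  convert hff' using 2
  funext y
  simp [g, pullback_apply]

/-- In positive degree, extend a primitive of `g` on `Z` to a cochain `k` on `X` and subtract `δk`,
which does not affect `δg`. -/
theorem exists_coboundary_eq_of_pullback_mem_coboundaries [T2Space X] [LocallyCompactSpace X]
    {Z : Set X} (hZ : IsClosed Z) {g : Cochain X p} (hg : g ∈ compactlySupported X p)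
    (hgZ : pullback (Subtype.val : Z → X) p g ∈ coboundaries Z p) :
    ∃ g' ∈ compactlySupported X p, coboundary X p g' = coboundary X p g ∧
      pullback (Subtype.val : Z → X) p g' ∈ locallyZero Z p := by
  cases p with
  | zero => exact ⟨g, hg, rfl, hgZ⟩
  | succ p =>
    obtain ⟨h, hh, hgh⟩ := mem_coboundaries_succ.1 hgZ
    obtain ⟨k, hk, hkh⟩ := exists_extension_of_isClosed hZ hh
    refine ⟨g - coboundary X p k, sub_mem hg (coboundary_mem_compactlySupported hk), ?_, ?_⟩
    · rw [map_sub, coboundary_coboundary, sub_zero]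
    · rw [map_sub, ← coboundary_pullback]
      have := add_mem hgh (coboundary_mem_locallyZero hkh)
      rwa [map_sub, sub_add_sub_cancel] at this

/-- Send each point to an almost nearest point of `Z`. Continuity at the points of `Z` is enough,
because Alexander–Spanier cochains can be pulled back along arbitrary functions. -/
theorem exists_near_retraction {X : Type*} [MetricSpace X] {Z : Set X} (hZ : IsClosed Z) :
    ∃ r : X → X, ∀ z ∈ Z, (∀ x, r x ∈ Z) ∧ r z = z ∧ ContinuousAt r z := by
  rcases Z.eq_empty_or_nonempty with rfl | hne
  · exact ⟨id, by simp⟩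
  -- The infimum need not be attained; the factor 2 leaves room, and makes `r` move a point by at
  -- most twice its distance to `z`, whence `ε / 3` below.
  have key : ∀ x, ∃ y ∈ Z, dist x y ≤ 2 * Metric.infDist x Z := fun x => by
    by_cases hx : x ∈ Z
    · exact ⟨x, hx, by simp [Metric.infDist_nonneg]⟩
    have h := (hZ.notMem_iff_infDist_pos hne).1 hx
    obtain ⟨y, hy, hxy⟩ := (Metric.infDist_lt_iff hne).1
      (show Metric.infDist x Z < 2 * Metric.infDist x Z by linarith)
    exact ⟨y, hy, hxy.le⟩
  choose r hrZ hr using key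
  have hid : ∀ z ∈ Z, r z = z := fun z hz => by
    have := hr z
    rw [Metric.infDist_zero_of_mem hz, mul_zero] at this
    exact (dist_le_zero.1 this).symm
  refine ⟨r, fun z hz => ⟨hrZ, hid z hz, ?_⟩⟩
  refine Metric.continuousAt_iff.2 fun ε hε => ⟨ε / 3, by positivity, fun {x} hx => ?_⟩
  rw [hid z hz]
  have h1 := Metric.infDist_le_dist_of_mem (x := x) hz
  have h2 := dist_triangle_left (r x) z x
  linarith [hr x]

end Complement

/-! ### Exactness for a closed subset of a metric space and its complement -/

section ComplementMetric

variable {X : Type*} [MetricSpace X] [LocallyCompactSpace X] {p : ℕ}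

/-- Take `e = δ(prism g)`, or `0` in degree zero. The prism starts at the identity, so it preserves
vanishing outside `K` although `r` is arbitrary. -/
theorem exists_homotopy_of_coboundary {X : Type*} [TopologicalSpace X] [T2Space X] (r : X → X)
    {g : Cochain X p} {K : Set X} (hK : IsCompact K) (hg : ∀ y, y 0 ∉ K → g y = 0) :
    ∃ e ∈ compactlySupported X p, coboundary X p e = 0 ∧
      e + prism id r p (coboundary X p g) = pullback r p g - g := by
  cases p with
  | zero => exact ⟨0, zero_mem _, map_zero _, by rw [zero_add, prism_coboundary_zero]; rfl⟩
  | succ p =>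
    refine ⟨coboundary X p (prism id r p g), coboundary_mem_compactlySupported ?_,
      coboundary_coboundary _, by rw [coboundary_prism_add]; rfl⟩
    exact compactlySupported_of_forall_notMem hK fun y hy => prism_apply_eq_zero_of_notMem _ _ hg hy

/-- The connecting map from `H_c(Z)` kills zero classes. After correction `g` is locally zero on
`Z`, but may be nonzero on tuples near `Z`. Replacing it by `g + e = r^* g - prism (δg)` keeps the
coboundary and moves the support off `Z`. -/
theorem pullback_coboundary_mem_coboundaries {Z : Set X} (hZ : IsClosed Z) {g : Cochain X p}
    (hg : g ∈ compactlySupported X p) (hδg : supp (coboundary X p g) ⊆ Zᶜ)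
    (hgZ : pullback (Subtype.val : Z → X) p g ∈ coboundaries Z p) :
    pullback (Subtype.val : ↥(Zᶜ) → X) (p + 1) (coboundary X p g) ∈
      coboundaries ↥(Zᶜ) (p + 1) := by
  obtain ⟨g₁, hg₁, hδ, hg₁Z⟩ := exists_coboundary_eq_of_pullback_mem_coboundaries hZ hg hgZ
  rw [← hδ] at hδg ⊢
  obtain ⟨g₂, K, hK, -, hdiff, hg₂⟩ := exists_cutoff g₁ hg₁ isOpen_univ (Set.subset_univ _)
  obtain ⟨r, hr⟩ := exists_near_retraction hZ
  obtain ⟨e, he, hδe, hhom⟩ := exists_homotopy_of_coboundary r hK hg₂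
  have hδ₂ : supp (coboundary X p g₂) ⊆ Zᶜ := by
    have h := supp_sub (coboundary X p g₁) (coboundary X p (g₁ - g₂))
    rw [← map_sub, sub_sub_cancel] at h
    refine h.trans (Set.union_subset hδg fun x hx => ?_)
    exact absurd hx (mem_locallyZero.1 (coboundary_mem_locallyZero hdiff) x)
  have hg₂Z : pullback (Subtype.val : Z → X) p g₂ ∈ locallyZero Z p := by
    have := sub_mem hg₁Z (pullback_mem_locallyZero continuous_subtype_val hdiff)
    rwa [← map_sub, sub_sub_cancel] at this
  have hsupp : g₂ + e ∈ supportedIn Zᶜ p := by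
    refine ⟨add_mem (compactlySupported_of_forall_notMem hK hg₂) he, fun z hz hzZ => hz ?_⟩
    obtain ⟨hrZ, hrz, hrc⟩ := hr z hzZ
    obtain ⟨V', hV', h0⟩ := notMem_supp.1 (mem_locallyZero.1 hg₂Z ⟨z, hzZ⟩)
    obtain ⟨V, hV, hVV'⟩ := mem_nhds_subtype _ _ _ |>.1 hV'
    obtain ⟨V₂, hV₂, h₂⟩ := notMem_supp.1 fun h => hδ₂ h hzZ
    -- `V` makes `g₂` vanish on tuples of points `r (y i)` of `Z`; `V₂`, imposed on both `y i` and
    -- `r (y i)`, kills the prism term.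
    refine ⟨V₂ ∩ r ⁻¹' (V ∩ V₂), Filter.inter_mem hV₂ (hrc.preimage_mem_nhds ?_), fun y hy => ?_⟩
    · rw [hrz]
      exact Filter.inter_mem hV hV₂
    · have e1 : prism id r p (coboundary X p g₂) y = 0 :=
        prism_apply_eq_zero id r h₂ (fun i => (hy i).1) fun i => (hy i).2.2
      have e2 : pullback r p g₂ y = 0 :=
        h0 (fun i => ⟨r (y i), hrZ _⟩) fun i => hVV' (hy i).2.1
      have e3 := congrFun hhom y
      simp only [Pi.add_apply, Pi.sub_apply, e1, e2] at e3
      rw [Pi.add_apply]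
      linear_combination e3
  refine mem_coboundaries_succ.2 ⟨pullback Subtype.val p (g₂ + e),
    pullback_val_mem_compactlySupported hZ.isOpen_compl hsupp, ?_⟩
  rw [coboundary_pullback, ← map_sub, map_add, hδe, add_zero, ← map_sub]
  exact pullback_mem_locallyZero continuous_subtype_val (coboundary_mem_locallyZero hdiff)

/-- If `Z` is closed in `X` and `H_c` is finite dimensional for `X` and `Z`, then it is so for the
complement of `Z`. -/
theorem FiniteHc.compl {Z : Set X} (hZ : IsClosed Z) (hX : FiniteHc X) (hZfin : FiniteHc Z) :
    FiniteHc ↥(Zᶜ) := fun p => by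
  have hU := hZ.isOpen_compl
  let A : Submodule ℂ (Cochain X p) :=
    supportedIn Zᶜ p ⊓ (locallyZero X (p + 1)).comap (coboundary X p)
  let S : A →ₗ[ℂ] Hc ↥(Zᶜ) p := Hc.mk _ p ∘ₗ
    (pullback (Subtype.val : ↥(Zᶜ) → X) p).restrict (q := cocycles ↥(Zᶜ) p) fun f hf =>
      ⟨pullback_val_mem_compactlySupported hU hf.1,
        pullback_mem_locallyZero continuous_subtype_val hf.2⟩
  let T : A →ₗ[ℂ] Hc X p := Hc.mk X p ∘ₗ
    Submodule.inclusion (show A ≤ cocycles X p from fun f hf => ⟨hf.1.1, hf.2⟩)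
  have hS : Function.Surjective S := fun v => by
    obtain ⟨f, rfl⟩ := Hc.mk_surjective v
    obtain ⟨g, hg, hfg⟩ := exists_extension_of_isOpen hU f.2.1
    refine ⟨⟨g, hg, mem_locallyZero.2 fun x hx => ?_⟩, ?_⟩
    · have hxU := hg.2 (supp_coboundary g hx)
      have h := sub_mem (mem_cocycles.1 f.2).2 (coboundary_mem_locallyZero hfg)
      rw [← map_sub, sub_sub_cancel, coboundary_pullback] at h
      refine mem_locallyZero.1 h ⟨x, hxU⟩ ?_
      rw [supp_pullback continuous_subtype_val hU.isOpenMap_subtype_val]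
      exact hx
    · exact (Hc.mk_eq_mk.2 (locallyZero_le_coboundaries hfg)).symm
  have hXp := hX p
  -- `S` and `T` send a cocycle supported in the complement to its class there and in `X`. Classes
  -- dying in `X` lie in the image `R` of the connecting map `S'`, which is controlled by `H_c(Z)`
  -- via `T'`; in degree zero `R = 0`.
  have hR : ∃ R : Submodule ℂ (Hc ↥(Zᶜ) p), Module.Finite ℂ R ∧ ∀ a, T a = 0 → S a ∈ R := by
    cases p with
    | zero =>
      refine ⟨⊥, inferInstance, fun a ha => (Submodule.mem_bot ℂ).2 (Hc.mk_eq_zero.2 ?_)⟩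
      exact pullback_mem_locallyZero continuous_subtype_val (Hc.mk_eq_zero.1 ha)
    | succ p =>
      let B : Submodule ℂ (Cochain X p) :=
        compactlySupported X p ⊓ (supportedIn Zᶜ (p + 1)).comap (coboundary X p)
      let S' : B →ₗ[ℂ] Hc ↥(Zᶜ) (p + 1) := Hc.mk _ (p + 1) ∘ₗ
        (pullback (Subtype.val : ↥(Zᶜ) → X) (p + 1) ∘ₗ coboundary X p).restrict
          (q := cocycles ↥(Zᶜ) (p + 1)) fun g hg => by
            refine ⟨pullback_val_mem_compactlySupported hU hg.2, ?_⟩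
            change coboundary _ (p + 1) (pullback _ (p + 1) (coboundary X p g)) ∈ locallyZero _ _
            rw [coboundary_pullback, coboundary_coboundary, map_zero]
            exact zero_mem _
      let T' : B →ₗ[ℂ] Hc Z p := Hc.mk Z p ∘ₗ
        (pullback (Subtype.val : Z → X) p).restrict (q := cocycles Z p) fun g hg => by
          refine ⟨pullback_mem_compactlySupported
            hZ.isClosedEmbedding_subtypeVal.isProperMap hg.1, mem_locallyZero.2 fun z hz => ?_⟩
          exact hg.2.2 (supp_pullback_subset continuous_subtype_val (coboundary X p g) hz) z.2
      have hZp := hZfin p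
      refine ⟨LinearMap.range S', finite_range_of_ker_le S' T' fun g hg => ?_, fun a ha => ?_⟩
      · exact Hc.mk_eq_zero.2 (pullback_coboundary_mem_coboundaries hZ g.2.1 g.2.2.2
          (Hc.mk_eq_zero.1 hg))
      · obtain ⟨g, hg, hag⟩ := mem_coboundaries_succ.1 (Hc.mk_eq_zero.1 ha)
        have hgB : coboundary X p g ∈ supportedIn Zᶜ (p + 1) := by
          refine ⟨coboundary_mem_compactlySupported hg, ?_⟩
          have h := supp_sub a.1 (a.1 - coboundary X p g)
          rw [sub_sub_cancel] at h
          refine h.trans (Set.union_subset a.2.1.2 fun x hx => ?_)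
          exact absurd hx (mem_locallyZero.1 hag x)
        refine ⟨⟨g, hg, hgB⟩, (Hc.mk_eq_mk.2 (locallyZero_le_coboundaries ?_)).symm⟩
        exact pullback_mem_locallyZero continuous_subtype_val hag
  obtain ⟨R, hRfin, hR⟩ := hR
  -- Modulo `R`, the map `S` factors through the image of `T` in `H_c(X)`.
  have hq : Module.Finite ℂ (LinearMap.range (R.mkQ ∘ₗ S)) :=
    finite_range_of_ker_le _ T fun a ha => (Submodule.Quotient.mk_eq_zero R).2 (hR a ha)
  have hsurj : Function.Surjective (R.mkQ ∘ₗ S) := by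
    rw [LinearMap.coe_comp]
    exact R.mkQ_surjective.comp hS
  rw [LinearMap.range_eq_top.2 hsurj] at hq
  have : Module.Finite ℂ (Hc ↥(Zᶜ) p ⧸ R) := Module.Finite.equiv Submodule.topEquiv
  exact Module.Finite.of_submodule_quotient R

end ComplementMetric

/-! ### Vanishing for half-spaces, and finiteness for `ℝ^N` -/

section HalfSpace

open scoped NNReal

theorem pullback_sub_pullback_mem_coboundaries {X : Type*} [TopologicalSpace X] [T2Space X]
    {p : ℕ} {φ : X → X} (hφ : IsProperMap φ) (ψ : X → X) {f : Cochain X p} {K : Set X}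
    (hK : IsCompact K) (hf : ∀ y, y 0 ∉ K → f y = 0)
    (h : prism φ ψ p (coboundary X p f) ∈ locallyZero X p) :
    pullback ψ p f - pullback φ p f ∈ coboundaries X p := by
  cases p with
  | zero =>
    rw [← prism_coboundary_zero]
    exact h
  | succ p =>
    rw [← coboundary_prism_add]
    refine add_mem (coboundary_mem_coboundaries ?_) (locallyZero_le_coboundaries h)
    exact compactlySupported_of_forall_notMem (hφ.isCompact_preimage hK) fun y hy =>
      prism_apply_eq_zero_of_notMem _ _ hf hy

/-- A Lebesgue number on the compact 1-thickening of `K` gives a uniform radius. For centres outside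
the thickening, points within distance 1 miss `K`, where every term of the coboundary vanishes. -/
theorem exists_forall_ball_coboundary_eq_zero {X : Type*} [MetricSpace X] [ProperSpace X]
    {p : ℕ} {f : Cochain X p} {K : Set X} (hK : IsCompact K) (hf : ∀ y, y 0 ∉ K → f y = 0)
    (h : coboundary X p f ∈ locallyZero X (p + 1)) :
    ∃ η > 0, ∀ x (y : Fin (p + 2) → X), (∀ i, y i ∈ Metric.ball x η) →
      coboundary X p f y = 0 := by
  have h' := fun x => notMem_supp.1 (mem_locallyZero.1 h x)
  choose U hU hfU using h'
  obtain ⟨η, hη, hηU⟩ := lebesgue_number_lemma_of_metric (hK.cthickening (r := 1))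
    (fun x => isOpen_interior (s := U x))
    fun x _ => Set.mem_iUnion.2 ⟨x, mem_interior_iff_mem_nhds.2 (hU x)⟩
  refine ⟨min η 1, lt_min hη one_pos, fun x y hy => ?_⟩
  by_cases hx : x ∈ Metric.cthickening 1 K
  · obtain ⟨z, hz⟩ := hηU x hx
    exact hfU z y fun i => interior_subset <| hz (Metric.ball_subset_ball (min_le_left _ _) (hy i))
  · have hyK : ∀ i, y i ∉ K := fun i hi => hx <| by
      refine Metric.mem_cthickening_of_dist_le x (y i) 1 K hi ?_
      rw [dist_comm]
      exact (Metric.ball_subset_ball (min_le_right _ _) (hy i)).le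
    rw [coboundary_apply]
    exact Finset.sum_eq_zero fun j _ => by rw [hf _ (hyK _), mul_zero]

variable {Y : Type*} [MetricSpace Y]

/-- Translation of the half-space `ℝ≥0 × Y`. -/
def shift (Y : Type*) (s : ℝ≥0) (x : ℝ≥0 × Y) : ℝ≥0 × Y := (x.1 + s, x.2)

theorem isometry_shift (s : ℝ≥0) : Isometry (shift Y s) :=
  Isometry.of_dist_eq fun x y => by simp [shift, Prod.dist_eq, NNReal.dist_eq]

theorem dist_shift_add (s ε : ℝ≥0) (x : ℝ≥0 × Y) :
    dist (shift Y (s + ε) x) (shift Y s x) = ε := by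
  simp [shift, Prod.dist_eq, NNReal.dist_eq]

variable [ProperSpace Y] {p : ℕ}

theorem isProperMap_shift (s : ℝ≥0) : IsProperMap (shift Y s) :=
  (isometry_shift s).isClosedEmbedding.isProperMap

/-- Pulling back along a shift by a small `ε` changes the cutoff cocycle by a coboundary, through
the prism between two nearby shifts. Enough shifts push the half-space off the compact set `K`, and
the pullback becomes zero. -/
theorem mem_coboundaries_halfSpace {f : Cochain (ℝ≥0 × Y) p} (hf : f ∈ cocycles (ℝ≥0 × Y) p) :
    f ∈ coboundaries (ℝ≥0 × Y) p := by
  obtain ⟨g, K, hK, -, hfg, hg⟩ := exists_cutoff f hf.1 isOpen_univ (Set.subset_univ _)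
  have hδg : coboundary _ p g ∈ locallyZero (ℝ≥0 × Y) (p + 1) := by
    have := sub_mem (mem_cocycles.1 hf).2 (coboundary_mem_locallyZero hfg)
    rwa [← map_sub, sub_sub_cancel] at this
  obtain ⟨η, hη, hηg⟩ := exists_forall_ball_coboundary_eq_zero hK hg hδg
  obtain ⟨ε, hε, hεη⟩ : ∃ ε : ℝ≥0, 0 < ε ∧ (ε : ℝ) < η :=
    ⟨Real.toNNReal (η / 2), Real.toNNReal_pos.2 (half_pos hη), by
      rw [Real.coe_toNNReal _ (half_pos hη).le]
      exact half_lt_self hη⟩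
  have hstep : ∀ k : ℕ, pullback (shift Y (k • ε)) p g - g ∈ coboundaries (ℝ≥0 × Y) p := by
    intro k
    induction k with
    | zero =>
      convert zero_mem (coboundaries (ℝ≥0 × Y) p)
      rw [sub_eq_zero]
      funext y
      simp [pullback_apply, shift]
    | succ k ih =>
      rw [← sub_add_sub_cancel _ (pullback (shift Y (k • ε)) p g)]
      refine add_mem (pullback_sub_pullback_mem_coboundaries (isProperMap_shift _) _ hK hg ?_) ih
      refine mem_locallyZero.2 fun x => notMem_supp.2 ⟨
        shift Y (k • ε) ⁻¹' Metric.ball (shift Y (k • ε) x) η ∩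
          shift Y ((k + 1) • ε) ⁻¹' Metric.ball (shift Y (k • ε) x) η, ?_, fun y hy => ?_⟩
      · refine Filter.inter_mem
          ((isometry_shift _).continuous.continuousAt.preimage_mem_nhds (Metric.ball_mem_nhds _ hη))
          ((isometry_shift _).continuous.continuousAt.preimage_mem_nhds
            (Metric.isOpen_ball.mem_nhds ?_))
        rwa [Metric.mem_ball, succ_nsmul, dist_shift_add]
      · exact prism_apply_eq_zero _ _ (hηg _) (fun i => (hy i).1) fun i => (hy i).2
  obtain ⟨R, hR⟩ := (hK.image continuous_fst).bddAbove
  -- `R + 1` rather than `R`, so that the shifted points lie strictly beyond the bound.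
  obtain ⟨k, hk⟩ := Archimedean.arch (R + 1) hε
  have h0 : pullback (shift Y (k • ε)) p g = 0 := by
    funext y
    refine hg _ fun hy => ?_
    have h1 : (y 0).1 + k • ε ≤ R := hR ⟨_, hy, rfl⟩
    have h2 : R + 1 ≤ R := hk.trans (le_add_self.trans h1)
    exact absurd h2 (by simp)
  have hgc := hstep k
  rw [h0, zero_sub] at hgc
  have := sub_mem (locallyZero_le_coboundaries hfg) hgc
  rwa [sub_neg_eq_add, sub_add_cancel] at this

theorem FiniteHc.halfSpace (Y : Type*) [MetricSpace Y] [ProperSpace Y] :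
    FiniteHc (ℝ≥0 × Y) := fun p => by
  have : Subsingleton (Hc (ℝ≥0 × Y) p) := by
    refine subsingleton_of_forall_eq 0 fun v => ?_
    obtain ⟨f, rfl⟩ := Hc.mk_surjective v
    exact Hc.mk_eq_zero.2 (mem_coboundaries_halfSpace f.2)
  infer_instance

/-- The half-space has vanishing `H_c`; its boundary is `Y`, and the logarithm identifies its
interior with `ℝ × Y`. -/
theorem FiniteHc.real_prod (h : FiniteHc Y) : FiniteHc (ℝ × Y) := by
  let Z : Set (ℝ≥0 × Y) := {x | x.1 = 0}
  have hZ : IsClosed Z := isClosed_eq continuous_fst continuous_const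
  let eZ : Y ≃ₜ Z :=
    { toFun y := ⟨(0, y), rfl⟩
      invFun x := x.1.2
      left_inv _ := rfl
      right_inv x := Subtype.ext (Prod.ext x.2.symm rfl)
      continuous_toFun := by fun_prop
      continuous_invFun := by fun_prop }
  let eU : ↥(Zᶜ) ≃ₜ ℝ × Y :=
    { toFun x := (Real.log x.1.1, x.1.2)
      invFun x := ⟨(Real.toNNReal (Real.exp x.1), x.2), fun h => by
        have h' : Real.toNNReal (Real.exp x.1) = 0 := h
        exact absurd (Real.toNNReal_eq_zero.1 h') (not_le.2 (Real.exp_pos _))⟩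
      left_inv x := by
        have hx : (x.1.1 : ℝ) ≠ 0 := fun h => x.2 (NNReal.coe_eq_zero.1 h)
        refine Subtype.ext (Prod.ext ?_ rfl)
        change Real.toNNReal (Real.exp (Real.log x.1.1)) = x.1.1
        rw [Real.exp_log (lt_of_le_of_ne (NNReal.coe_nonneg _) hx.symm), Real.toNNReal_coe]
      right_inv x := by
        refine Prod.ext ?_ rfl
        change Real.log (Real.toNNReal (Real.exp x.1)) = x.1
        rw [Real.coe_toNNReal _ (Real.exp_pos _).le, Real.log_exp]
      continuous_toFun := by
        refine Continuous.prodMk (Continuous.log (by fun_prop) fun x h => ?_) (by fun_prop)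
        exact x.2 (NNReal.coe_eq_zero.1 h)
      continuous_invFun := by fun_prop }
  exact (FiniteHc.compl hZ (FiniteHc.halfSpace Y) (h.of_homeomorph eZ)).of_homeomorph eU

theorem FiniteHc.fin_real (N : ℕ) : FiniteHc (Fin N → ℝ) := by
  induction N with
  | zero => exact FiniteHc.of_finite _
  | succ N ih =>
    exact ih.real_prod.of_homeomorph (Fin.consEquivL ℝ fun _ : Fin (N + 1) => ℝ).toHomeomorph

theorem FiniteHc.of_finiteDimensional (E : Type*) [NormedAddCommGroup E] [NormedSpace ℝ E]
    [FiniteDimensional ℝ E] : FiniteHc E :=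
  (FiniteHc.fin_real _).of_homeomorph
    (ContinuousLinearEquiv.ofFinrankEq
      (Module.finrank_fin_fun ℝ (n := Module.finrank ℝ E))).toHomeomorph

end HalfSpace

/-! ### Complements of subspace arrangements -/

section Arrangement

/-- Deletion and restriction: removing `S` from the smaller complement inside `H` removes a closed
subset, itself an arrangement complement inside `H ⊓ S`. Hence the induction for varying `H`. -/
theorem FiniteHc.arrangement {E : Type*} [NormedAddCommGroup E] [NormedSpace ℝ E]
    [FiniteDimensional ℝ E] (L : List (Submodule ℝ E)) (H : Submodule ℝ E) :
    FiniteHc ↥{x : E | x ∈ H ∧ ∀ S ∈ L, x ∉ S} := by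
  induction L generalizing H with
  | nil =>
    refine (FiniteHc.of_finiteDimensional H).of_homeomorph (Homeomorph.setCongr ?_)
    ext x
    simp
  | cons S L ih =>
    have hcl : ∀ S : Submodule ℝ E, IsClosed (S : Set E) := fun S => S.closed_of_finiteDimensional
    let M : Set E := {x : E | x ∈ H ∧ ∀ S ∈ L, x ∉ S}
    have hM : IsLocallyClosed M := by
      have hop : IsOpen {x : E | ∀ S ∈ L, x ∉ S} := by
        have : {x : E | ∀ S ∈ L, x ∉ S} = ⋂ S ∈ {S | S ∈ L}, (S : Set E)ᶜ := by
          ext x; simp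
        rw [this]
        exact (List.finite_toSet L).isOpen_biInter fun S _ => (hcl S).isOpen_compl
      exact (hcl H).isLocallyClosed.inter hop.isLocallyClosed
    have := hM.locallyCompactSpace
    let Z : Set M := {x | x.1 ∈ S}
    have hZ : IsClosed Z := (hcl S).preimage continuous_subtype_val
    let eZ : ↥{x : E | x ∈ H ⊓ S ∧ ∀ S ∈ L, x ∉ S} ≃ₜ Z :=
      { toFun x := ⟨⟨x.1, x.2.1.1, x.2.2⟩, x.2.1.2⟩
        invFun x := ⟨x.1.1, ⟨x.1.2.1, x.2⟩, x.1.2.2⟩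
        left_inv _ := rfl
        right_inv _ := rfl
        continuous_toFun := by fun_prop
        continuous_invFun := by fun_prop }
    let eU : ↥(Zᶜ) ≃ₜ ↥{x : E | x ∈ H ∧ ∀ S' ∈ S :: L, x ∉ S'} :=
      { toFun x := ⟨x.1.1, x.1.2.1, List.forall_mem_cons.2 ⟨x.2, x.1.2.2⟩⟩
        invFun x := ⟨⟨x.1, x.2.1, (List.forall_mem_cons.1 x.2.2).2⟩,
          (List.forall_mem_cons.1 x.2.2).1⟩
        left_inv _ := rfl
        right_inv _ := rfl
        continuous_toFun := by fun_prop
        continuous_invFun := by fun_prop }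
    exact (FiniteHc.compl hZ (ih H) ((ih (H ⊓ S)).of_homeomorph eZ)).of_homeomorph eU

theorem pow_eq_pow_iff_exists_rootsOfUnity {n : ℕ} [NeZero n] (a b : ℂ) :
    a ^ n = b ^ n ↔ ∃ ζ : rootsOfUnity n ℂ, a = ((ζ : ℂˣ) : ℂ) * b := by
  constructor
  · intro h
    by_cases hb : b = 0
    · refine ⟨1, ?_⟩
      rw [hb, zero_pow (NeZero.ne n)] at h
      simp [hb, (pow_eq_zero_iff (NeZero.ne n)).1 h]
    · have hab : (a / b) ^ n = 1 := by rw [div_pow, h, div_self (pow_ne_zero _ hb)]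
      refine ⟨rootsOfUnity.mkOfPowEq (a / b) hab, ?_⟩
      rw [rootsOfUnity.coe_mkOfPowEq, div_mul_cancel₀ _ hb]
  · rintro ⟨ζ, rfl⟩
    rw [mul_pow, rootsOfUnity_pow, one_mul]

/-- The condition `zᵢⁿ ≠ zⱼⁿ` says `zᵢ ≠ ζ zⱼ` for every `ζ ∈ μ_n`, so only finitely many
hyperplanes are removed. -/
theorem FiniteHc.T (n m : ℕ) [NeZero n] : FiniteHc (T n m) := by
  classical
  let coord (i : Fin m) : (Fin m → ℂ) →ₗ[ℝ] ℂ := LinearMap.proj i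
  let A : Finset (Submodule ℝ (Fin m → ℂ)) :=
    Finset.univ.image (fun i => LinearMap.ker (coord i)) ∪
      ((Finset.univ : Finset (Fin m × Fin m × rootsOfUnity n ℂ)).filter fun a => a.1 ≠ a.2.1).image
        fun a => LinearMap.ker (coord a.1 - (((a.2.2 : ℂˣ) : ℂ)) • coord a.2.1)
  refine (FiniteHc.arrangement A.toList ⊤).of_homeomorph (Homeomorph.setCongr ?_)
  ext z
  have h1 : ∀ i, z ∈ LinearMap.ker (coord i) ↔ z i = 0 := fun i => Iff.rfl
  have h2 : ∀ i j (ζ : rootsOfUnity n ℂ),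
      z ∈ LinearMap.ker (coord i - ((ζ : ℂˣ) : ℂ) • coord j) ↔ z i = ((ζ : ℂˣ) : ℂ) * z j :=
    fun i j ζ => sub_eq_zero
  constructor
  · rintro ⟨-, h⟩
    refine ⟨fun i hi => h _ (Finset.mem_toList.2 (Finset.mem_union_left _
      (Finset.mem_image_of_mem _ (Finset.mem_univ i)))) ((h1 i).2 hi), fun i j hij hz => ?_⟩
    obtain ⟨ζ, hζ⟩ := (pow_eq_pow_iff_exists_rootsOfUnity _ _).1 hz
    exact h _ (Finset.mem_toList.2 (Finset.mem_union_right _ (Finset.mem_image_of_mem _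
      (Finset.mem_filter.2 ⟨Finset.mem_univ (i, j, ζ), hij⟩)))) ((h2 i j ζ).2 hζ)
  · rintro ⟨hz0, hz⟩
    refine ⟨Submodule.mem_top, fun S hS hzS => ?_⟩
    rcases Finset.mem_union.1 (Finset.mem_toList.1 hS) with hS | hS
    · obtain ⟨i, -, rfl⟩ := Finset.mem_image.1 hS
      exact hz0 i ((h1 i).1 hzS)
    · obtain ⟨⟨i, j, ζ⟩, hij, rfl⟩ := Finset.mem_image.1 hS
      exact hz i j (Finset.mem_filter.1 hij).2
        ((pow_eq_pow_iff_exists_rootsOfUnity _ _).2 ⟨ζ, (h2 i j ζ).1 hzS⟩)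

end Arrangement

/-! ### Quotients by finite groups acting freely -/

section Average

variable {K X Y : Type*} [Group K] [MulAction K X] {p : ℕ}

/-- The average of the translates of a cochain. -/
def average (K : Type*) {X : Type*} [Group K] [MulAction K X] [Fintype K] (p : ℕ) :
    Cochain X p →ₗ[ℂ] Cochain X p :=
  (Fintype.card K : ℂ)⁻¹ • ∑ k : K, translate p k

theorem average_apply [Fintype K] (f : Cochain X p) :
    average K p f = (Fintype.card K : ℂ)⁻¹ • ∑ k : K, translate p k f := by
  simp [average]

theorem translate_average [Fintype K] (k : K) (f : Cochain X p) :
    translate p k (average K p f) = average K p f := by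
  have h : ∀ k' : K, translate p k (translate p k' f) = translate p (k * k') f := fun k' => by
    funext x
    change f (fun i => k'⁻¹ • k⁻¹ • x i) = f (fun i => (k * k')⁻¹ • x i)
    simp [mul_smul]
  simp only [average_apply, map_smul, map_sum, h]
  congr 1
  exact Fintype.sum_equiv (Equiv.mulLeft k) _ _ fun _ => rfl

theorem average_of_invariant [Fintype K] {f : Cochain X p} (hf : ∀ k : K, translate p k f = f) :
    average K p f = f := by
  simp only [average_apply, hf, Finset.sum_const, Finset.card_univ]
  rw [← Nat.cast_smul_eq_nsmul ℂ, inv_smul_smul₀ (Nat.cast_ne_zero.2 Fintype.card_ne_zero)]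

theorem coboundary_average [Fintype K] (f : Cochain X p) :
    coboundary X p (average K p f) = average K (p + 1) (coboundary X p f) := by
  simp only [average_apply, map_smul, map_sum, translate_coboundary]

theorem average_mem [Fintype K] {S : Submodule ℂ (Cochain X p)}
    (hS : ∀ (k : K) (f), f ∈ S → translate p k f ∈ S) {f : Cochain X p} (hf : f ∈ S) :
    average K p f ∈ S := by
  rw [average_apply]
  exact S.smul_mem _ (S.sum_mem fun k _ => hS k f hf)

theorem translate_pullback {φ : X → Y} (hφ : ∀ (k : K) x, φ (k • x) = φ x) (k : K)
    (f : Cochain Y p) : translate p k (pullback φ p f) = pullback φ p f :=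
  funext fun x => congrArg f (funext fun i => hφ k⁻¹ (x i))

end Average

section Descent

variable {X Y : Type*} [TopologicalSpace X] [TopologicalSpace Y] {p : ℕ}

theorem mem_locallyZero_of_pullback {φ : X → Y} (hc : Continuous φ) (ho : IsOpenMap φ)
    (hs : Function.Surjective φ) {f : Cochain Y p} (hf : pullback φ p f ∈ locallyZero X p) :
    f ∈ locallyZero Y p := mem_locallyZero.2 fun y hy => by
  obtain ⟨x, rfl⟩ := hs y
  refine mem_locallyZero.1 hf x ?_
  rwa [supp_pullback hc ho]

theorem mem_compactlySupported_of_pullback {φ : X → Y} (hc : Continuous φ) (ho : IsOpenMap φ)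
    (hs : Function.Surjective φ) {f : Cochain Y p} (hf : pullback φ p f ∈ compactlySupported X p) :
    f ∈ compactlySupported Y p := by
  rw [mem_compactlySupported, supp_pullback hc ho] at hf
  rw [mem_compactlySupported, ← Set.image_preimage_eq (supp f) hs]
  exact hf.image hc

end Descent

section Quotient

variable {K X Y : Type*} [Group K] [MetricSpace X] [MulAction K X] {p : ℕ}

/-- `x'` is closer to `x` than all its other translates. -/
def Near (K : Type*) {X : Type*} [Group K] [MetricSpace X] [MulAction K X] (x x' : X) : Prop :=
  ∀ k : K, k ≠ 1 → dist x x' < dist x (k • x')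

theorem Near.smul [IsIsometricSMul K X] {x x' : X} (h : Near K x x') (g : K) :
    Near K (g • x) (g • x') := fun k hk => by
  have h1 := h (g⁻¹ * k * g) fun h => hk (by simpa [mul_assoc, inv_mul_eq_one] using h)
  rw [dist_smul]
  rwa [← dist_smul g x ((g⁻¹ * k * g) • x'), smul_smul, ← mul_assoc, mul_inv_cancel_left,
    mul_smul] at h1

theorem Near.eq_one {x x' : X} (h : Near K x x') {k : K} (h' : Near K x (k • x')) : k = 1 := by
  by_contra hk
  have h1 := h' k⁻¹ (inv_ne_one.2 hk)
  rw [inv_smul_smul] at h1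
  exact lt_asymm h1 (h k hk)

/-- At `(x, x)` the inequality reads `0 < dist x (k • x)`, which is freeness; it is an open
condition and `K` is finite. -/
theorem exists_nhds_forall_near [IsIsometricSMul K X] [Finite K]
    (hfree : ∀ (k : K) (x : X), k • x = x → k = 1)
    (x : X) :
    ∃ U ∈ 𝓝 x, ∀ a ∈ U, ∀ b ∈ U, Near K a b := by
  have h : ∀ᶠ q : X × X in 𝓝 x ×ˢ 𝓝 x, Near K q.1 q.2 := by
    rw [← nhds_prod_eq]
    refine Filter.eventually_all.2 fun k => ?_
    by_cases hk : k = 1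
    · exact Filter.Eventually.of_forall fun q h => absurd hk h
    have hopen : IsOpen {q : X × X | dist q.1 q.2 < dist q.1 (k • q.2)} :=
      isOpen_lt (by fun_prop) (by fun_prop)
    have hx : (x, x) ∈ {q : X × X | dist q.1 q.2 < dist q.1 (k • q.2)} := by
      rw [Set.mem_ofPred_eq, dist_self]
      exact dist_pos.2 fun h => hk (hfree k x h.symm)
    filter_upwards [hopen.mem_nhds hx] with q hq _ using hq
  exact Filter.eventually_prod_self_iff.1 h

/-- An invariant cochain comes from the quotient, up to a locally zero one. -/
theorem exists_pullback_sub_mem_locallyZero [IsIsometricSMul K X] [Finite K]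
    (hfree : ∀ (k : K) (x : X), k • x = x → k = 1) {φ : X → Y}
    (hfib : ∀ x x', φ x = φ x' → ∃ k : K, k • x = x') {f : Cochain X p}
    (hf : ∀ k : K, translate p k f = f) :
    ∃ h : Cochain Y p, pullback φ p h - f ∈ locallyZero X p := by
  classical
  -- A lift with all entries near the first is unique up to one common element of `K`, so invariance
  -- of `f` makes its value independent of the chosen lift.
  let lifts (y : Fin (p + 1) → Y) (x : Fin (p + 1) → X) : Prop :=
    (∀ i, φ (x i) = y i) ∧ ∀ i, Near K (x 0) (x i)
  let h : Cochain Y p := fun y => if hy : ∃ x, lifts y x then f hy.choose else 0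
  refine ⟨h, mem_locallyZero.2 fun x => ?_⟩
  obtain ⟨U, hU, hnear⟩ := exists_nhds_forall_near hfree x
  refine notMem_supp.2 ⟨U, hU, fun z hz => ?_⟩
  have hzl : lifts (fun i => φ (z i)) z := ⟨fun _ => rfl, fun i => hnear _ (hz 0) _ (hz i)⟩
  have hex : ∃ x, lifts (fun i => φ (z i)) x := ⟨z, hzl⟩
  rw [Pi.sub_apply, pullback_apply, sub_eq_zero]
  simp only [h, dif_pos hex]
  obtain ⟨hφ, hn⟩ := hex.choose_spec
  choose k hk using fun i => hfib _ _ (hφ i).symm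
  have hkk : ∀ i, k i = k 0 := fun i => by
    have h1 := (hn i).smul (k 0)⁻¹
    rw [← hk i, ← hk 0, inv_smul_smul, smul_smul] at h1
    exact (inv_mul_eq_one.1 ((hzl.2 i).eq_one h1)).symm
  have h2 := congrFun (hf (k 0)) hex.choose
  rw [← h2]
  change f (fun i => (k 0)⁻¹ • hex.choose i) = f z
  congr 1
  funext i
  rw [← hk i, hkk i, inv_smul_smul]

/-- A proper open surjection whose fibres are the orbits of a finite group `K` acting freely. -/
structure IsFreeQuotient (K : Type*) {X Y : Type*} [Group K] [MetricSpace X] [TopologicalSpace Y]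
    [MulAction K X] (φ : X → Y) : Prop where
  isProperMap : IsProperMap φ
  isOpenMap : IsOpenMap φ
  surjective : Function.Surjective φ
  apply_smul : ∀ (k : K) x, φ (k • x) = φ x
  exists_smul_eq : ∀ x x', φ x = φ x' → ∃ k : K, k • x = x'
  free : ∀ (k : K) (x : X), k • x = x → k = 1

namespace IsFreeQuotient

variable [TopologicalSpace Y] [IsIsometricSMul K X] {φ : X → Y}

theorem exists_descent [Finite K] (h : IsFreeQuotient K φ) {f : Cochain X p}
    (hf : ∀ k : K, translate p k f = f) (hfc : f ∈ compactlySupported X p) :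
    ∃ g ∈ compactlySupported Y p, pullback φ p g - f ∈ locallyZero X p := by
  obtain ⟨g, hg⟩ := exists_pullback_sub_mem_locallyZero h.free h.exists_smul_eq hf
  refine ⟨g, mem_compactlySupported_of_pullback h.isProperMap.continuous h.isOpenMap h.surjective ?_,
    hg⟩
  have := add_mem (locallyZero_le_compactlySupported hg) hfc
  rwa [sub_add_cancel] at this

/-- A primitive upstairs may be averaged, since the pulled-back cocycle is invariant; the average
then descends. -/
theorem map_injective [Fintype K] (h : IsFreeQuotient K φ) (p : ℕ) :
    Function.Injective (Hc.map φ h.isProperMap p) := by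
  refine (injective_iff_map_eq_zero _).2 fun v hv => ?_
  obtain ⟨f, rfl⟩ := Hc.mk_surjective v
  rw [Hc.map_mk, Hc.mk_eq_zero] at hv
  rw [Hc.mk_eq_zero]
  have hc := h.isProperMap.continuous
  cases p with
  | zero => exact mem_locallyZero_of_pullback hc h.isOpenMap h.surjective hv
  | succ p =>
    obtain ⟨g, hg, hfg⟩ := mem_coboundaries_succ.1 hv
    obtain ⟨g', hg', hgg'⟩ := h.exists_descent (fun k => translate_average k g)
      (average_mem (fun k _ => translate_mem_compactlySupported k) hg)
    refine mem_coboundaries_succ.2 ⟨g', hg',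
      mem_locallyZero_of_pullback hc h.isOpenMap h.surjective ?_⟩
    have h1 := average_mem (fun (k : K) _ => translate_mem_locallyZero k) hfg
    rw [map_sub, average_of_invariant (translate_pullback h.apply_smul · f.1),
      ← coboundary_average] at h1
    have h2 := sub_mem h1 (coboundary_mem_locallyZero hgg')
    rw [map_sub, coboundary_pullback, sub_sub_sub_cancel_right, ← map_sub] at h2
    exact h2

/-- Averaging a representative of an invariant class leaves the class unchanged and makes the
cochain invariant, so that it descends. -/
theorem mem_range_map [Fintype K] (h : IsFreeQuotient K φ) {v : Hc X p}
    (hv : ∀ k : K, HcRep K X p k v = v) : v ∈ LinearMap.range (Hc.map φ h.isProperMap p) := by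
  have hc := h.isProperMap.continuous
  obtain ⟨f, rfl⟩ := Hc.mk_surjective v
  have hav : average K p f.1 ∈ cocycles X p :=
    average_mem (fun k _ => translate_mem_cocycles k) f.2
  have hmk : Hc.mk X p ⟨_, hav⟩ = Hc.mk X p f := by
    have h1 : (⟨_, hav⟩ : cocycles X p) = (Fintype.card K : ℂ)⁻¹ • ∑ k : K,
        (translate p k).restrict (fun _ hf => translate_mem_cocycles k hf) f :=
      Subtype.ext (by simp [average_apply])
    have h2 : ∀ k : K, Hc.mk X p ((translate p k).restrict
        (fun _ hf => translate_mem_cocycles k hf) f) = Hc.mk X p f := hv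
    rw [h1, map_smul, map_sum, Finset.sum_congr rfl fun k _ => h2 k, Finset.sum_const,
      Finset.card_univ, ← Nat.cast_smul_eq_nsmul ℂ,
      inv_smul_smul₀ (Nat.cast_ne_zero.2 Fintype.card_ne_zero)]
  obtain ⟨g, hg, hgf⟩ := h.exists_descent (fun k => translate_average k f.1) hav.1
  have hgcoc : g ∈ cocycles Y p := by
    refine ⟨hg, mem_locallyZero_of_pullback hc h.isOpenMap h.surjective ?_⟩
    have := add_mem (coboundary_mem_locallyZero hgf) (mem_cocycles.1 hav).2
    rwa [← map_add, sub_add_cancel] at this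
  refine ⟨Hc.mk Y p ⟨g, hgcoc⟩, ?_⟩
  rw [← hmk, Hc.map_mk, Hc.mk_eq_mk]
  exact locallyZero_le_coboundaries hgf

end IsFreeQuotient

end Quotient

/-! ### The covering `T(n,m) → T^{(n)}(1,m)` -/

section Covering

variable {n m : ℕ}

/-- The map `z ↦ ((zᵢⁿ), z₁⋯z_m)` on the ambient affine spaces. -/
def powProd (n m : ℕ) (z : Fin m → ℂ) : Option (Fin m) → ℂ :=
  fun o => o.elim (∏ i, z i) fun i => z i ^ n

theorem preimage_powProd [NeZero n] : powProd n m ⁻¹' Tcover n m = T n m := by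
  ext z
  constructor
  · rintro ⟨⟨h0, h⟩, -, -⟩
    refine ⟨fun i hi => h0 i ?_, fun i j hij hz => h i j hij ?_⟩
    · change z i ^ n = 0
      rw [hi, zero_pow (NeZero.ne n)]
    · change (z i ^ n) ^ 1 = (z j ^ n) ^ 1
      rw [hz]
  · rintro ⟨h0, h⟩
    refine ⟨⟨fun i => pow_ne_zero _ (h0 i), fun i j hij => ?_⟩,
      show ∏ i, z i ≠ 0 from Finset.prod_ne_zero_iff.2 fun i _ => h0 i,
      (Finset.prod_pow Finset.univ n z).symm⟩
    change (z i ^ n) ^ 1 ≠ (z j ^ n) ^ 1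
    rw [pow_one, pow_one]
    exact h i j hij

/-- Forgetting the product coordinate leaves a product of the proper maps `z ↦ zⁿ`, and a continuous
first factor of a proper composite is proper here. -/
theorem isProperMap_powProd [NeZero n] : IsProperMap (powProd n m) := by
  have hcont : Continuous (powProd n m) := by
    refine continuous_pi fun o => ?_
    cases o with
    | none => exact continuous_finsetProd Finset.univ fun (i : Fin m) _ => continuous_apply i
    | some i => exact (continuous_apply i).pow n
  have hpow : IsProperMap fun z : ℂ => z ^ n := by
    have h := Polynomial.isProperMap_eval (R := ℂ) (Polynomial.X ^ n)
      (by simpa using Nat.pos_of_ne_zero (NeZero.ne n))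
    simpa using h
  exact isProperMap_of_comp_of_t2 (g := fun x : Option (Fin m) → ℂ => fun i => x (some i)) hcont
    (by fun_prop) (IsProperMap.pi_map fun _ : Fin m => hpow)

/-- The map `T(n,m) → T^{(n)}(1,m)`, `z ↦ ((zᵢⁿ), z₁⋯z_m)`. -/
def coverMap (n m : ℕ) [NeZero n] (z : T n m) : Tcover n m :=
  ⟨powProd n m z.1, preimage_powProd.ge z.2⟩

theorem isProperMap_coverMap [NeZero n] : IsProperMap (coverMap n m) :=
  ((isProperMap_powProd (n := n) (m := m)).restrictPreimage (Tcover n m)).comp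
    (Homeomorph.setCongr (preimage_powProd (n := n) (m := m)).symm).isProperMap

theorem coverMap_smul [NeZero n] (g : W n m) (z : T n m) :
    coverMap n m (g • z) = (∏ i, g.left i) • g.right • coverMap n m z := by
  refine Subtype.ext (funext fun o => ?_)
  cases o with
  | none =>
    change ∏ i, ((g.left i : ℂˣ) : ℂ) * z.1 (g.right⁻¹ i) =
      (((∏ i, g.left i : rootsOfUnity n ℂ) : ℂˣ) : ℂ) * ∏ i, z.1 i
    rw [Finset.prod_mul_distrib, Equiv.prod_comp g.right⁻¹ z.1]
    simp
  | some i =>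
    change (((g.left i : ℂˣ) : ℂ) * z.1 (g.right⁻¹ i)) ^ n = z.1 (g.right⁻¹ i) ^ n
    rw [mul_pow, rootsOfUnity_pow, one_mul]

/-- The product homomorphism `μ_n^m → μ_n`. -/
def prodHom (n m : ℕ) : (Fin m → rootsOfUnity n ℂ) →* rootsOfUnity n ℂ where
  toFun ζ := ∏ i, ζ i
  map_one' := by simp
  map_mul' ζ ξ := by simp [Finset.prod_mul_distrib]

theorem prodHom_apply (ζ : Fin m → rootsOfUnity n ℂ) : prodHom n m ζ = ∏ i, ζ i := rfl

theorem prodHom_surjective (hm : 1 ≤ m) : Function.Surjective (prodHom n m) := fun δ =>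
  ⟨Pi.mulSingle ⟨0, hm⟩ δ, by rw [prodHom_apply, Finset.prod_pi_mulSingle']; simp⟩

/-- The group of the covering `T(n,m) → T^{(n)}(1,m)`. -/
def deckGroup (n m : ℕ) : Subgroup (W n m) :=
  (prodHom n m).ker.map SemidirectProduct.inl

theorem mem_deckGroup {g : W n m} :
    g ∈ deckGroup n m ↔ ∃ ζ, prodHom n m ζ = 1 ∧ SemidirectProduct.inl ζ = g := Iff.rfl

instance [NeZero n] : Finite (W n m) :=
  Finite.of_injective (fun g => (g.left, g.right)) fun _ _ hgh =>
    SemidirectProduct.ext (congrArg Prod.fst hgh) (congrArg Prod.snd hgh)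

instance [NeZero n] : IsIsometricSMul (W n m) (T n m) := by
  have key : ∀ (g : W n m) (z z' : T n m), dist (g • z) (g • z') ≤ dist z z' := fun g z z' => by
    rw [Subtype.dist_eq]
    refine (dist_pi_le_iff dist_nonneg).2 fun i => ?_
    rw [W_smul_apply, W_smul_apply, dist_eq_norm, ← mul_sub, norm_mul,
      Complex.norm_eq_one_of_pow_eq_one (rootsOfUnity_pow _) (NeZero.ne n), one_mul, ← dist_eq_norm]
    exact dist_le_pi_dist z.1 z'.1 _
  refine ⟨fun g => Isometry.of_dist_eq fun z z' => (key g z z').antisymm ?_⟩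
  simpa using key g⁻¹ (g • z) (g • z')

instance [NeZero n] : IsIsometricSMul (deckGroup n m) (T n m) :=
  ⟨fun k => isometry_smul (T n m) (k : W n m)⟩

theorem coverMap_inl_smul [NeZero n] (ζ : Fin m → rootsOfUnity n ℂ) (z : T n m) :
    coverMap n m ((SemidirectProduct.inl ζ : W n m) • z) = prodHom n m ζ • coverMap n m z := by
  rw [coverMap_smul, SemidirectProduct.left_inl, SemidirectProduct.right_inl, one_smul]
  rfl

theorem coverMap_inr_smul [NeZero n] (w : Equiv.Perm (Fin m)) (z : T n m) :
    coverMap n m ((SemidirectProduct.inr w : W n m) • z) = w • coverMap n m z := by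
  rw [coverMap_smul, SemidirectProduct.left_inr, SemidirectProduct.right_inr]
  simp

theorem exists_inl_smul_eq [NeZero n] {z z' : T n m} (h : ∀ i, z.1 i ^ n = z'.1 i ^ n) :
    ∃ ζ : Fin m → rootsOfUnity n ℂ, (SemidirectProduct.inl ζ : W n m) • z = z' := by
  choose ζ hζ using fun i => (pow_eq_pow_iff_exists_rootsOfUnity (n := n) _ _).1 (h i).symm
  exact ⟨ζ, Subtype.ext (funext fun i => (hζ i).symm)⟩

theorem eq_one_of_smul_eq_self (x : Tcover n m) {ζ : rootsOfUnity n ℂ} (h : ζ • x = x) :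
    ζ = 1 := by
  have h1 : ((ζ : ℂˣ) : ℂ) * x.1 none = x.1 none := congrFun (congrArg Subtype.val h) none
  exact Subtype.ext (Units.ext (mul_eq_right₀ x.2.2.1 |>.1 h1))

/-- Arbitrary `n`-th roots of the coordinates have the right product up to some `δ ∈ μ_n`; scaling
by a tuple with product `δ` corrects it. -/
theorem surjective_coverMap [NeZero n] (hm : 1 ≤ m) : Function.Surjective (coverMap n m) := by
  intro x
  choose z hz using fun i => IsAlgClosed.exists_pow_nat_eq (x.1 (some i))
    (Nat.pos_of_ne_zero (NeZero.ne n))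
  have hzT : z ∈ T n m := by
    refine ⟨fun i hi => x.2.1.1 i ?_, fun i j hij h => x.2.1.2 i j hij ?_⟩
    · change x.1 (some i) = 0
      rw [← hz i, hi, zero_pow (NeZero.ne n)]
    · change x.1 (some i) ^ 1 = x.1 (some j) ^ 1
      rw [pow_one, pow_one, ← hz, ← hz, h]
  have hprod : x.1 none ^ n = (∏ i, z i) ^ n := by
    rw [x.2.2.2, ← Finset.prod_pow]
    exact Finset.prod_congr rfl fun i _ => (hz i).symm
  obtain ⟨δ, hδ⟩ := (pow_eq_pow_iff_exists_rootsOfUnity _ _).1 hprod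
  obtain ⟨ζ, rfl⟩ := prodHom_surjective hm δ
  refine ⟨(SemidirectProduct.inl ζ : W n m) • ⟨z, hzT⟩, ?_⟩
  rw [coverMap_inl_smul]
  refine Subtype.ext (funext fun o => ?_)
  cases o with
  | none => exact hδ.symm
  | some i => exact hz i

theorem isFreeQuotient_coverMap [NeZero n] (hm : 1 ≤ m) :
    IsFreeQuotient (deckGroup n m) (coverMap n m) := by
  have hinv : ∀ (k : deckGroup n m) z, coverMap n m (k • z) = coverMap n m z := by
    rintro ⟨k, hk⟩ z
    obtain ⟨ζ, hζ, rfl⟩ := mem_deckGroup.1 hk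
    change coverMap n m ((SemidirectProduct.inl ζ : W n m) • z) = _
    rw [coverMap_inl_smul, hζ, one_smul]
  have hfib : ∀ z z', coverMap n m z = coverMap n m z' → ∃ k : deckGroup n m, k • z = z' := by
    intro z z' h
    have hpow : ∀ i, z.1 i ^ n = z'.1 i ^ n := fun i =>
      congrFun (congrArg Subtype.val h) (some i)
    obtain ⟨ζ, rfl⟩ := exists_inl_smul_eq hpow
    rw [coverMap_inl_smul] at h
    exact ⟨⟨_, mem_deckGroup.2 ⟨ζ, eq_one_of_smul_eq_self _ h.symm, rfl⟩⟩, rfl⟩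
  refine ⟨isProperMap_coverMap, fun U hU => ?_, surjective_coverMap hm, hinv, hfib, ?_⟩
  -- Openness: a closed continuous surjection is a quotient map, and the saturation of `U` is a
  -- union of translates of `U`.
  · have hq : Topology.IsQuotientMap (coverMap n m) :=
      isProperMap_coverMap.isClosedMap.isQuotientMap isProperMap_coverMap.continuous
        (surjective_coverMap hm)
    rw [← hq.isOpen_preimage]
    have : coverMap n m ⁻¹' (coverMap n m '' U) =
        ⋃ k : deckGroup n m, (fun z => k • z) ⁻¹' U := by
      ext z
      simp only [Set.mem_preimage, Set.mem_image, Set.mem_iUnion]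
      constructor
      · rintro ⟨z', hz', h⟩
        obtain ⟨k, rfl⟩ := hfib _ _ h.symm
        exact ⟨k, hz'⟩
      · rintro ⟨k, hk⟩
        exact ⟨_, hk, hinv k z⟩
    rw [this]
    exact isOpen_iUnion fun k => hU.preimage (continuous_const_smul k)
  · rintro ⟨k, hk⟩ z h
    obtain ⟨ζ, -, rfl⟩ := mem_deckGroup.1 hk
    have hζ : ζ = 1 := funext fun i => by
      have h1 : ((ζ i : ℂˣ) : ℂ) * z.1 i = z.1 i := congrFun (congrArg Subtype.val h) i
      exact Subtype.ext (Units.ext (mul_eq_right₀ (z.2.1 i) |>.1 h1))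
    refine Subtype.ext ?_
    change (SemidirectProduct.inl ζ : W n m) = 1
    rw [hζ, map_one]

end Covering

/-! ### Equality of dimensions -/

section Dimension

/-- Incomparability gives one inequality; lying over and going up lift chains of primes for the
other. -/
theorem ringKrullDim_eq_of_isIntegral {R S : Type*} [CommRing R] [CommRing S] [Algebra R S]
    [Algebra.IsIntegral R S] (hinj : Function.Injective (algebraMap R S)) :
    ringKrullDim S = ringKrullDim R := by
  apply le_antisymm
  · refine Order.krullDim_le_of_strictMono (PrimeSpectrum.comap (algebraMap R S)) fun P Q h => ?_
    have hlt : P.asIdeal < Q.asIdeal := h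
    obtain ⟨x, hxQ, hxP⟩ := SetLike.exists_of_lt hlt
    exact Ideal.comap_lt_comap_of_integral_mem_sdiff hlt.le ⟨hxQ, hxP⟩
      (Algebra.IsIntegral.isIntegral x)
  · refine iSup_le fun l => ?_
    obtain ⟨P, -, hP, hPl⟩ := Ideal.exists_ideal_over_prime_of_isIntegral (S := S)
      l.head.asIdeal ⊥ (by
        rw [← RingHom.ker_eq_comap_bot, (RingHom.injective_iff_ker_eq_bot _).1 hinj]
        exact bot_le)
    have : P.LiesOver l.head.asIdeal := ⟨hPl.symm⟩
    have := Algebra.HasGoingUp.of_isIntegral (R := R) (S := S)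
    obtain ⟨L, hL, -⟩ := Ideal.exists_ltSeries_of_hasGoingUp l P
    rw [← hL]
    exact le_iSup (fun L : LTSeries (PrimeSpectrum S) => (L.length : WithBot ℕ∞)) L

/-- Surjectivity of the covering makes substitution injective on coordinate rings, and the extension
is integral because each `Xᵢⁿ` is in the image. -/
theorem dim_T_eq_dim_Tcover (n m : ℕ) [NeZero n] (hm : 1 ≤ m) :
    dim (T n m) = dim (Tcover n m) := by
  let F : MvPolynomial (Option (Fin m)) ℂ →ₐ[ℂ] MvPolynomial (Fin m) ℂ :=
    MvPolynomial.aeval fun o => o.elim (∏ i, MvPolynomial.X i) fun i => MvPolynomial.X i ^ n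
  let I := MvPolynomial.vanishingIdeal ℂ (T n m)
  let J := MvPolynomial.vanishingIdeal ℂ (Tcover n m)
  have hF : ∀ (z : Fin m → ℂ) q, MvPolynomial.aeval z (F q) =
      MvPolynomial.aeval (powProd n m z) q := fun z q => by
    rw [← AlgHom.comp_apply]
    congr 1
    refine MvPolynomial.algHom_ext fun o => ?_
    cases o <;> simp [F, powProd, map_prod]
  have hJ : J = I.comap F.toRingHom := by
    ext q
    change q ∈ J ↔ F q ∈ I
    simp only [I, J, MvPolynomial.mem_vanishingIdeal_iff, hF]
    constructor
    · exact fun h z hz => h _ (coverMap n m ⟨z, hz⟩).2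
    · intro h x hx
      obtain ⟨z, hz⟩ := surjective_coverMap (n := n) hm ⟨x, hx⟩
      have hzx : powProd n m z.1 = x := congrArg Subtype.val hz
      rw [← hzx]
      exact h _ z.2
  let f : MvPolynomial (Option (Fin m)) ℂ ⧸ J →+* MvPolynomial (Fin m) ℂ ⧸ I :=
    Ideal.quotientMap I F.toRingHom hJ.le
  let _ : Algebra (MvPolynomial (Option (Fin m)) ℂ ⧸ J) (MvPolynomial (Fin m) ℂ ⧸ I) := f.toAlgebra
  have hinj : Function.Injective f := Ideal.quotientMap_injective' hJ.ge
  have hf : ∀ q, f (Ideal.Quotient.mk J q) = Ideal.Quotient.mk I (F q) := fun q =>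
    Ideal.quotientMap_mk
  have : Algebra.IsIntegral (MvPolynomial (Option (Fin m)) ℂ ⧸ J)
      (MvPolynomial (Fin m) ℂ ⧸ I) := ⟨fun a => by
    obtain ⟨q, rfl⟩ := Ideal.Quotient.mk_surjective a
    induction q using MvPolynomial.induction_on with
    | C c =>
      have : Ideal.Quotient.mk I (MvPolynomial.C c) =
          f (Ideal.Quotient.mk J (MvPolynomial.C c)) := by
        rw [hf]
        congr 1
        exact (MvPolynomial.algHom_C F c).symm
      rw [this]
      exact isIntegral_algebraMap
    | add p q hp hq =>
      rw [map_add]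
      exact hp.add hq
    | mul_X p i hp =>
      rw [map_mul]
      refine hp.mul (IsIntegral.of_pow (Nat.pos_of_ne_zero (NeZero.ne n)) ?_)
      have : Ideal.Quotient.mk I (MvPolynomial.X i) ^ n =
          f (Ideal.Quotient.mk J (MvPolynomial.X (some i))) := by
        rw [hf, ← map_pow]
        congr 1
        simp [F]
      rw [this]
      exact isIntegral_algebraMap⟩
  unfold dim
  rw [ringKrullDim_eq_of_isIntegral (R := MvPolynomial (Option (Fin m)) ℂ ⧸ J) hinj]

end Dimension

/-! ### Comparison of traces -/

section Trace

/-- An operator with values in a subspace has the same trace as its restriction to that subspace. -/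
theorem trace_eq_trace_of_injective {U V : Type*} [AddCommGroup U] [AddCommGroup V] [Module ℂ U]
    [Module ℂ V] [Module.Finite ℂ V] (j : U →ₗ[ℂ] V) (hj : Function.Injective j)
    (F : U →ₗ[ℂ] U) (E : V →ₗ[ℂ] V) (hEF : ∀ u, E (j u) = j (F u))
    (hE : ∀ v, E v ∈ LinearMap.range j) :
    LinearMap.trace ℂ U F = LinearMap.trace ℂ V E := by
  rw [← LinearMap.trace_restrict_eq_of_forall_mem (LinearMap.range j) E hE,
    ← LinearMap.trace_conj' F (LinearEquiv.ofInjective j hj)]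
  congr 1
  refine LinearMap.ext fun v => Subtype.ext ?_
  obtain ⟨u, rfl⟩ := (LinearEquiv.ofInjective j hj).surjective v
  rw [LinearEquiv.conj_apply_apply, LinearEquiv.symm_apply_apply]
  exact (hEF u).symm

theorem Hc.map_HcRep {Γ Δ X Y : Type*} [TopologicalSpace X] [TopologicalSpace Y] [Group Γ]
    [Group Δ] [MulAction Γ X] [MulAction Δ Y] [ContinuousConstSMul Γ X] [ContinuousConstSMul Δ Y]
    {φ : X → Y} (hφ : IsProperMap φ) {γ : Γ} {δ : Δ} (h : ∀ x, φ (γ • x) = δ • φ x) {p : ℕ}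
    (v : Hc Y p) :
    Hc.map φ hφ p (HcRep Δ Y p δ v) = HcRep Γ X p γ (Hc.map φ hφ p v) := by
  obtain ⟨f, rfl⟩ := Hc.mk_surjective v
  refine congrArg Submodule.Quotient.mk (Subtype.ext (funext fun x => ?_))
  change f.1 (fun i => δ⁻¹ • φ (x i)) = f.1 (fun i => φ (γ⁻¹ • x i))
  refine congrArg f.1 (funext fun i => ?_)
  rw [inv_smul_eq_iff, ← h, smul_inv_smul]

variable {n m : ℕ} [NeZero n]

theorem card_pi_rootsOfUnity (n m : ℕ) [NeZero n] :
    (Fintype.card (Fin m → rootsOfUnity n ℂ) : ℂ) = (n : ℂ) ^ m := by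
  rw [Fintype.card_fun, Fintype.card_fin, ← Nat.card_eq_fintype_card, Complex.card_rootsOfUnity,
    Nat.cast_pow]

/-- The operator `n^{-m} ∑_ζ χ(ζ₁⋯ζ_m) w ζ` on `H_c^p(T(n,m))`. -/
def twistedAverage (p : ℕ) (w : Equiv.Perm (Fin m)) (χ : rootsOfUnity n ℂ →* ℂˣ) :
    Hc (T n m) p →ₗ[ℂ] Hc (T n m) p :=
  (1 / (n : ℂ) ^ m) • ∑ ζ : Fin m → rootsOfUnity n ℂ, ((χ (∏ i, ζ i) : ℂˣ) : ℂ) •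
    HcRep (W n m) (T n m) p (SemidirectProduct.inr w * SemidirectProduct.inl ζ)

theorem twistedAverage_apply (p : ℕ) (w : Equiv.Perm (Fin m)) (χ : rootsOfUnity n ℂ →* ℂˣ)
    (v : Hc (T n m) p) : twistedAverage p w χ v = (1 / (n : ℂ) ^ m) •
      ∑ ζ : Fin m → rootsOfUnity n ℂ, ((χ (prodHom n m ζ) : ℂˣ) : ℂ) •
        HcRep (W n m) (T n m) p (SemidirectProduct.inr w * SemidirectProduct.inl ζ) v := by
  simp [twistedAverage, prodHom_apply]

/-- Moving `ξ` past `w` permutes its entries and preserves their product; reindexing the sum by `ζ ↦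
ξ' ζ` then produces the factor. -/
theorem HcRep_inl_twistedAverage (p : ℕ) (w : Equiv.Perm (Fin m)) (χ : rootsOfUnity n ℂ →* ℂˣ)
    (v : Hc (T n m) p) (ξ : Fin m → rootsOfUnity n ℂ) :
    HcRep (W n m) (T n m) p (SemidirectProduct.inl ξ) (twistedAverage p w χ v) =
      ((χ⁻¹ (prodHom n m ξ) : ℂˣ) : ℂ) • twistedAverage p w χ v := by
  let ξ' : Fin m → rootsOfUnity n ℂ := fun i => ξ (w i)
  have hξ' : prodHom n m ξ' = prodHom n m ξ := Equiv.prod_comp w ξ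
  have hcomm : ∀ ζ, (SemidirectProduct.inl ξ * (SemidirectProduct.inr w * SemidirectProduct.inl ζ) :
      W n m) = SemidirectProduct.inr w * SemidirectProduct.inl (ξ' * ζ) := fun ζ => by
    have h : (SemidirectProduct.inl ξ : W n m) =
        SemidirectProduct.inr w * SemidirectProduct.inl ξ' * SemidirectProduct.inr w⁻¹ := by
      rw [← SemidirectProduct.inl_aut]
      congr 1
      funext i
      change ξ i = ξ (w (w⁻¹ i))
      simp
    rw [h, map_mul]
    simp [mul_assoc]
  rw [twistedAverage_apply, map_smul, map_sum, smul_comm]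
  congr 1
  rw [Finset.smul_sum]
  refine Fintype.sum_equiv (Equiv.mulLeft ξ') _ _ fun ζ => ?_
  rw [Equiv.coe_mulLeft, map_smul, ← Module.End.mul_apply, ← map_mul, hcomm, smul_smul,
    map_mul (prodHom n m), hξ', map_mul χ, MonoidHom.inv_apply, Units.val_mul, ← mul_assoc,
    Units.inv_mul, one_mul]

theorem trace_isotypic_eq (hm : 1 ≤ m) (p : ℕ) (w : Equiv.Perm (Fin m))
    (χ : rootsOfUnity n ℂ →* ℂˣ) :
    LinearMap.trace ℂ (isotypic (Tcover n m) p χ⁻¹)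
        ((HcRep (Equiv.Perm (Fin m)) (Tcover n m) p w).restrict (HcRep_mem_isotypic w χ⁻¹)) =
      LinearMap.trace ℂ (Hc (T n m) p) (twistedAverage p w χ) := by
  have := Fintype.ofFinite (deckGroup n m)
  have hq := isFreeQuotient_coverMap (n := n) hm
  have hinj := hq.map_injective p
  have := FiniteHc.T n m p
  have hinl : ∀ ζ u, Hc.map (coverMap n m) hq.isProperMap p
        (HcRep (rootsOfUnity n ℂ) (Tcover n m) p (prodHom n m ζ) u) =
      HcRep (W n m) (T n m) p (SemidirectProduct.inl ζ)
        (Hc.map (coverMap n m) hq.isProperMap p u) :=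
    fun ζ u => Hc.map_HcRep _ (coverMap_inl_smul ζ) u
  have hinr : ∀ u, Hc.map (coverMap n m) hq.isProperMap p
        (HcRep (Equiv.Perm (Fin m)) (Tcover n m) p w u) =
      HcRep (W n m) (T n m) p (SemidirectProduct.inr w)
        (Hc.map (coverMap n m) hq.isProperMap p u) :=
    fun u => Hc.map_HcRep _ (coverMap_inr_smul w) u
  refine trace_eq_trace_of_injective
    (Hc.map (coverMap n m) hq.isProperMap p ∘ₗ (isotypic (Tcover n m) p χ⁻¹).subtype)
    ?_ _ _ (fun u => ?_) fun v => ?_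
  · rw [LinearMap.coe_comp]
    exact hinj.comp (Submodule.subtype_injective _)
  -- On an isotypic class `ζ` acts by `χ⁻¹` of its product, so all `n ^ m` terms agree and the
  -- average is `w`.
  · have hterm : ∀ ζ, ((χ (prodHom n m ζ) : ℂˣ) : ℂ) • HcRep (W n m) (T n m) p
          (SemidirectProduct.inr w * SemidirectProduct.inl ζ)
          (Hc.map (coverMap n m) hq.isProperMap p u.1) =
        Hc.map (coverMap n m) hq.isProperMap p
          (HcRep (Equiv.Perm (Fin m)) (Tcover n m) p w u.1) := fun ζ => by
      rw [map_mul, Module.End.mul_apply, ← hinl, u.2, map_smul, map_smul, smul_smul,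
        MonoidHom.inv_apply, Units.mul_inv, one_smul, hinr]
    rw [LinearMap.comp_apply, Submodule.subtype_apply, twistedAverage_apply,
      Finset.sum_congr rfl fun ζ _ => hterm ζ, Finset.sum_const, Finset.card_univ,
      ← Nat.cast_smul_eq_nsmul ℂ, card_pi_rootsOfUnity, smul_smul,
      one_div_mul_cancel (pow_ne_zero _ (Nat.cast_ne_zero.2 (NeZero.ne n))), one_smul]
    rfl
  -- The deck group consists of tuples with product 1, hence fixes the average, which therefore
  -- descends to some `u`. That `u` is isotypic is checked after the injective pullback, lifting `δ`
  -- to a tuple.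
  · obtain ⟨u, hu⟩ := hq.mem_range_map (v := twistedAverage p w χ v) (by
      rintro ⟨k, hk⟩
      obtain ⟨ζ, hζ, rfl⟩ := mem_deckGroup.1 hk
      change HcRep (W n m) (T n m) p (SemidirectProduct.inl ζ) _ = _
      rw [HcRep_inl_twistedAverage, hζ, map_one, Units.val_one, one_smul])
    refine ⟨⟨u, fun δ => hinj ?_⟩, hu⟩
    obtain ⟨ξ, rfl⟩ := prodHom_surjective hm δ
    rw [hinl, hu, HcRep_inl_twistedAverage, map_smul, hu]

end Trace

/-- `shiftedSum` as a linear map. -/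
def shiftedSumHom (d : ℕ) : (ℕ → ℂ) →ₗ[ℂ] LaurentSeries ℂ where
  toFun := shiftedSum d
  map_add' a b := by
    rw [shiftedSum, shiftedSum, shiftedSum, ← mul_add, ← map_add]
    rfl
  map_smul' c a := by
    have h : PowerSeries.mk (c • a) = PowerSeries.C c * PowerSeries.mk a := by
      ext i
      simp
    rw [shiftedSum, shiftedSum, h, map_mul, HahnSeries.ofPowerSeries_C, mul_left_comm,
      HahnSeries.C_mul_eq_smul, RingHom.id_apply]

theorem shiftedSumHom_apply (d : ℕ) (a : ℕ → ℂ) : shiftedSumHom d a = shiftedSum d a := rfl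

end WeightPoly

end

theorem proposition2p1 (n m : ℕ) [NeZero n] (hm : 1 ≤ m) (w : Equiv.Perm (Fin m))
    (χ : rootsOfUnity n ℂ →* ℂˣ) :
    WeightPoly.isotypicWeightPoly w χ⁻¹ (WeightPoly.Tcover n m) =
      (1 / (n : ℂ) ^ m) • ∑ ζ : Fin m → rootsOfUnity n ℂ,
        ((χ (∏ i, ζ i) : ℂˣ) : ℂ) •
          WeightPoly.weightPoly
            (SemidirectProduct.inr w * SemidirectProduct.inl ζ : WeightPoly.W n m)
            (WeightPoly.T n m) := by
  -- Equal dimensions give both sides the same shift; by linearity only coefficient sequences remain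
  -- to be compared.
  simp only [WeightPoly.isotypicWeightPoly, WeightPoly.weightPoly,
    WeightPoly.dim_T_eq_dim_Tcover n m hm, ← WeightPoly.shiftedSumHom_apply]
  simp only [← map_smul, ← map_sum]
  congr 1
  funext i
  rw [WeightPoly.trace_isotypic_eq hm, WeightPoly.twistedAverage, map_smul, map_sum]
  simp only [map_smul, Pi.smul_apply, Finset.sum_apply, smul_eq_mul, Finset.mul_sum]
  exact Finset.sum_congr rfl fun ζ _ => by ring
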